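/- Let $\mathcal G=(\mathcal N,\mathcal E)$, $\mathcal E\subseteq\mathcal N\times\mathcal N$, be a finite directed graph that is connected (orientations forgotten), with real line susceptances $B_{ij}$ ($ij\in\mathcal E$), damping coefficients $D_i>0$, power injections $P_i^{in}\in\mathbb R$ and load limits $\Omega_i=[\underline d_i,\overline d_i]$ with $\underline d_i,\overline d_i\in\mathbb R$; put $\Omega=\prod_{i}\Omega_i$. Let the cost of load $i$ be $f_i=f_{i,0}+f_{i,1}+f_{i,2}$, where $f_{i,1}$ is the indicator function of $\Omega_i$ ($0$ on $\Omega_i$ and $+\infty$ outside), $f_{i,2}:\mathbb R\to\mathbb R$ is convex, and $f_{i,0}:\mathbb R\to\mathbb R$ is differentiable. Put $$u_{i,1}=P_i^{in}-d_i-D_i\omega_i+\sum_{k:ki\in\mathcal E}P_{ki}-\sum_{j:ij\in\mathcal E}P_{ij},\qquad u_{i,2}=P_i^{in}-d_i+\sum_{k:ki\in\mathcal E}B_{ki}(\hat\theta_k-\hat\theta_i)-\sum_{j:ij\in\mathcal E}B_{ij}(\hat\theta_i-\hat\theta_j).$$ The reformulated optimal load control (ROLC) problem without line limits is $$\min_{d,\hat\theta,\omega,P}\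 \sum_{i\in\mathcal N}\Big(f_i(d_i)+\tfrac{D_i}{2}\omega_i^2\Big)\quad\text{subject to}\quad u_{i,1}=0,\ u_{i,2}=0\ \text{ for all } i\in\mathcal N .$$ Write $\mathbf{prox}_f(y)=\arg\min_x\{f(x)+\frac12(x-y)^2\}$ and let $\kappa\in(0,1)$. The distributed proximal primal-dual (DPPD) dynamics without line limits, with stepsize $1$ for $\eta,d,\hat\theta,P$ and $\frac12$ for $\omega,\mu$ (the multiplier $\lambda$ of the constraint $u_{\cdot,1}=0$ being identified with $\omega$), are $$\begin{aligned} \dot\eta_i&=\mathbf{prox}_{f_{i,2}}(d_i-\kappa\eta_i)-d_i,\\ \dot d_i&=\mathbf{prox}_{f_{i,1}}\big(d_i-\nabla f_{i,0}(d_i)+\kappa\eta_i+\omega_i+u_{i,1}+\mu_i+u_{i,2}\big)-d_i,\\ \dot{\hat\theta}_i&=\sum_{j:ij\in\mathcal E}B_{ij}(\mu_i+u_{i,2}-\mu_j-u_{j,2})-\sum_{k:ki\in\mathcal E}B_{ki}(\mu_k+u_{k,2}-\mu_i-u_{i,2}),\\ \dot P_{ij}&=\omega_i+u_{i,1}-\omega_j-u_{j,1},\qquad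 \dot\omega_i=\tfrac12u_{i,1},\qquad \dot\mu_i=\tfrac12u_{i,2}. \end{aligned}$$ Assume: (1) there is $\beta>1$ such that every $f_{i,0}$ is $\beta$-strongly convex; (2) (Slater's condition without line limits) there are $\tilde d\in\mathrm{relint}(\Omega)$ and $\tilde\theta\in\mathbb R^{\mathcal N}$ with $u_{i,2}(\tilde d,\tilde\theta)=0$ for all $i\in\mathcal N$. Then: 1. If $d_i(0)\in\Omega_i$ for all $i$, then along every trajectory of the DPPD dynamics, on any time interval starting at $0$, $d_i(t)\in\Omega_i$ for all $i$ and all $t$. 2. Every trajectory $(\eta,d,\hat\theta,P,\omega,\mu)$ of the DPPD dynamics, on any time interval starting at $0$ and from any initial value, is bounded. 3. Every trajectory $(\eta,d,\hat\theta,P,\omega,\mu)$ of the DPPD dynamics on $[0,\infty)$, from any initial value, converges as $t\to\infty$ to an equilibrium point $(\eta^*,d^*,\hat\theta^*,P^*,\omega^*,\mu^*)$ of the dynamics, and $(d^*,\hat\theta^*,P^*,\omega^*)$ is an optimal solution of the ROLC problem without line limits. -/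

import Mathlib

/-- Data of the optimal load control problem on a power network with bus set `N`. The lines form a
directed graph, a line being the ordered pair (source, end), connected when orientations are
forgotten. -/
structure LoadControl (N : Type*) where
  /-- transmission lines -/
  lines : Finset (N × N)
  connected : (SimpleGraph.fromRel fun i j => (i, j) ∈ lines).Connected
  /-- susceptances of the lines -/
  B : lines → ℝ
  /-- damping coefficients -/
  D : N → ℝ
  D_pos : ∀ i, 0 < D i
  /-- uncontrollable power injections -/
  Pin : N → ℝ
  /-- lower capacity limits of the loads -/
  dlo : N → ℝ
  /-- upper capacity limits of the loads -/
  dhi : N → ℝ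
  /-- smooth parts of the regulation costs -/
  f₀ : N → ℝ → ℝ
  /-- nonsmooth parts of the regulation costs (other than the capacity limits) -/
  f₂ : N → ℝ → ℝ

/-- The proximal operator (with parameter `1`) of `f : ℝ → ℝ ∪ {±∞}`: a minimizer of
`x ↦ f x + (x - y)² / 2`. For proper lower semicontinuous convex `f` it exists and is unique. -/
noncomputable def prox (f : ℝ → EReal) (y : ℝ) : ℝ :=
  Classical.epsilon fun x : ℝ =>
    IsMinOn (fun z : ℝ => f z + (((z - y) ^ 2 / 2 : ℝ) : EReal)) Set.univ x

namespace LoadControl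

variable {N : Type*}

/-- The capacity limits of a single load. -/
def cap (S : LoadControl N) (i : N) : Set ℝ := Set.Icc (S.dlo i) (S.dhi i)

/-- The set of load vectors within the capacity limits. -/
def capSet (S : LoadControl N) : Set (N → ℝ) := {d | ∀ i, d i ∈ S.cap i}

open Classical in
/-- The indicator function of the capacity limits of a load. -/
noncomputable def f₁ (S : LoadControl N) (i : N) (x : ℝ) : EReal :=
  if x ∈ S.cap i then 0 else ⊤

/-- The nonsmooth part `f₂` as an extended-real-valued function. -/
noncomputable def f₂E (S : LoadControl N) (i : N) (x : ℝ) : EReal := (S.f₂ i x : EReal)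

/-- The regulation cost of a load. -/
noncomputable def cost (S : LoadControl N) (i : N) (x : ℝ) : EReal :=
  (S.f₀ i x : EReal) + S.f₁ i x + S.f₂E i x

section Flows

variable [DecidableEq N]

/-- The sum of `φ` over the lines that start at bus `i`. -/
noncomputable def outSum (S : LoadControl N) (φ : S.lines → ℝ) (i : N) : ℝ :=
  ∑ e : S.lines with e.1.1 = i, φ e

/-- The sum of `φ` over the lines that end at bus `i`. -/
noncomputable def inSum (S : LoadControl N) (φ : S.lines → ℝ) (i : N) : ℝ :=
  ∑ e : S.lines with e.1.2 = i, φ e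

/-- `B_{ij} (x_i - x_j)` on the line `ij`. -/
noncomputable def lineFlow (S : LoadControl N) (x : N → ℝ) (e : S.lines) : ℝ :=
  S.B e * (x e.1.1 - x e.1.2)

/-- The residual of the power balance in terms of the line flows `P` and frequencies `ω`. -/
noncomputable def u₁ (S : LoadControl N) (d ω : N → ℝ) (P : S.lines → ℝ) (i : N) : ℝ :=
  S.Pin i - d i - S.D i * ω i + S.inSum P i - S.outSum P i

/-- The residual of the power balance in terms of the virtual phase angles `θ`. -/
noncomputable def u₂ (S : LoadControl N) (d θ : N → ℝ) (i : N) : ℝ :=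
  S.Pin i - d i + S.inSum (S.lineFlow θ) i - S.outSum (S.lineFlow θ) i

/-- Slater's condition without line limits. -/
def Slater (S : LoadControl N) : Prop :=
  ∃ d ∈ intrinsicInterior ℝ S.capSet, ∃ θ : N → ℝ, ∀ i, S.u₂ d θ i = 0

/-- The feasible points `(d, θ, ω, P)` of the reformulated optimal load control problem without
line limits; the capacity limits of the loads are part of the cost. -/
def Feasible (S : LoadControl N) (d θ ω : N → ℝ) (P : S.lines → ℝ) : Prop :=
  (∀ i, S.u₁ d ω P i = 0) ∧ ∀ i, S.u₂ d θ i = 0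

/-- The objective of the reformulated optimal load control problem. -/
noncomputable def objective [Fintype N] (S : LoadControl N) (d ω : N → ℝ) : EReal :=
  ∑ i, (S.cost i (d i) + ((S.D i / 2 * ω i ^ 2 : ℝ) : EReal))

/-- Optimal solutions of the reformulated optimal load control problem without line limits. -/
def IsOptimal [Fintype N] (S : LoadControl N) (d θ ω : N → ℝ) (P : S.lines → ℝ) : Prop :=
  S.Feasible d θ ω P ∧
    ∀ (d' θ' ω' : N → ℝ) (P' : S.lines → ℝ), S.Feasible d' θ' ω' P' →
      S.objective d ω ≤ S.objective d' ω'

end Flows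

/-- States of the algorithm. The multiplier `λ` of the first power balance is identified with `ω`
by the algorithm. -/
structure State (S : LoadControl N) where
  η : N → ℝ
  d : N → ℝ
  θ : N → ℝ
  P : S.lines → ℝ
  ω : N → ℝ
  μ : N → ℝ

variable [DecidableEq N]

/-- The right-hand side of the distributed proximal primal-dual dynamics without line limits, with
stepsizes `1` for `η, d, θ, P` and `1 / 2` for `ω = λ` and `μ`. -/
noncomputable def dppd (S : LoadControl N) (κ : ℝ) (s : S.State) : S.State :=
  let p : N → ℝ := fun i => s.ω i + S.u₁ s.d s.ω s.P i
  let q : N → ℝ := fun i => s.μ i + S.u₂ s.d s.θ i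
  { η := fun i => prox (S.f₂E i) (s.d i - κ * s.η i) - s.d i
    d := fun i => prox (S.f₁ i) (s.d i - deriv (S.f₀ i) (s.d i) + κ * s.η i + p i + q i) - s.d i
    θ := fun i => S.outSum (S.lineFlow q) i - S.inSum (S.lineFlow q) i
    P := fun e => p e.1.1 - p e.1.2
    ω := fun i => S.u₁ s.d s.ω s.P i / 2
    μ := fun i => S.u₂ s.d s.θ i / 2 }

/-- Equilibrium points of the dynamics. -/
def IsEquilibrium (S : LoadControl N) (κ : ℝ) (s : S.State) : Prop :=
  S.dppd κ s = ⟨0, 0, 0, 0, 0, 0⟩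

/-- `z` is a trajectory of the dynamics on a time interval `J` that starts at time `0`. -/
structure IsTrajectoryOn (S : LoadControl N) (κ : ℝ) (J : Set ℝ) (z : ℝ → S.State) : Prop where
  interval : J.OrdConnected
  zero_mem : (0 : ℝ) ∈ J
  nonneg : ∀ t ∈ J, 0 ≤ t
  η : ∀ t ∈ J, ∀ i, HasDerivWithinAt (fun τ => (z τ).η i) ((S.dppd κ (z t)).η i) J t
  d : ∀ t ∈ J, ∀ i, HasDerivWithinAt (fun τ => (z τ).d i) ((S.dppd κ (z t)).d i) J t
  θ : ∀ t ∈ J, ∀ i, HasDerivWithinAt (fun τ => (z τ).θ i) ((S.dppd κ (z t)).θ i) J t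
  P : ∀ t ∈ J, ∀ e, HasDerivWithinAt (fun τ => (z τ).P e) ((S.dppd κ (z t)).P e) J t
  ω : ∀ t ∈ J, ∀ i, HasDerivWithinAt (fun τ => (z τ).ω i) ((S.dppd κ (z t)).ω i) J t
  μ : ∀ t ∈ J, ∀ i, HasDerivWithinAt (fun τ => (z τ).μ i) ((S.dppd κ (z t)).μ i) J t

/-- All coordinates of the state are bounded by `M` in absolute value. -/
def State.BoundedBy {S : LoadControl N} (s : S.State) (M : ℝ) : Prop :=
  (∀ i, |s.η i| ≤ M) ∧ (∀ i, |s.d i| ≤ M) ∧ (∀ i, |s.θ i| ≤ M) ∧ (∀ e, |s.P e| ≤ M) ∧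
    (∀ i, |s.ω i| ≤ M) ∧ ∀ i, |s.μ i| ≤ M

/-- The trajectory `z` converges to the state `s` as time tends to infinity. -/
def ConvergesTo {S : LoadControl N} (z : ℝ → S.State) (s : S.State) : Prop :=
  (∀ i, Filter.Tendsto (fun t => (z t).η i) Filter.atTop (nhds (s.η i))) ∧
  (∀ i, Filter.Tendsto (fun t => (z t).d i) Filter.atTop (nhds (s.d i))) ∧
  (∀ i, Filter.Tendsto (fun t => (z t).θ i) Filter.atTop (nhds (s.θ i))) ∧
  (∀ e, Filter.Tendsto (fun t => (z t).P e) Filter.atTop (nhds (s.P e))) ∧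
  (∀ i, Filter.Tendsto (fun t => (z t).ω i) Filter.atTop (nhds (s.ω i))) ∧
  ∀ i, Filter.Tendsto (fun t => (z t).μ i) Filter.atTop (nhds (s.μ i))

end LoadControl

/-! Each proximal map is characterised by a variational inequality (`prox_variational`). At a rest
point both residuals vanish and these inequalities become the KKT conditions
(`Regular.isEquilibrium_iff`), which by convexity imply optimality (`Regular.isOptimal`). One
equilibrium exists: a minimiser comes from compactness of the capacity box, its multipliers from
Slater's condition by separation (`Regular.exists_isEquilibrium`).

Invariance of the box: `d' + d` always lies in it, so `exp t` times the signed distance to either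
endpoint is monotone.

Stability rests on `lyapunov`, centred at an equilibrium `b`. It contains the Bregman distance of
`f₀` and the squares of `p = ω - b.ω + u₁` and `q = μ - b.μ + u₂`. Its partial derivatives in `d`,
`θ`, `P` thus reproduce the driving terms of the dynamics, and the cross term in `η` and `d` matches
the proximal coupling. It dominates the squared distance to `b` (`Regular.distSq_le_lyapunov`) and
decreases at a rate of at least `(1 - κ) / 2` times the squared speed (`Regular.lyapunovDeriv_le`).
Hence trajectories are bounded, and on `[0, ∞)` the speed tends to zero along some sequence of
times. A cluster point of the states there is an equilibrium; recentring the Lyapunov function at it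
forces the whole trajectory to converge to that point. -/

open Filter Topology Set

/-! ### Lagrange multipliers and subgradients -/

/-- A convex function that attains its minimum over `C ∩ (x₀ + M)` at `x₀` admits a Lagrange
multiplier, provided that some point of `x₀ + M` lies in the relative interior of `C`. -/
theorem exists_multiplier_of_isMinOn {V : Type*} [AddCommGroup V] [Module ℝ V] {C : Set V}
    {F : V → ℝ} (hF : ConvexOn ℝ C F) (W M : Submodule ℝ V) {x₀ x₁ : V} (hx₀ : x₀ ∈ C)
    (hmin : ∀ x ∈ C, x - x₀ ∈ M → F x₀ ≤ F x) (hW : ∀ x ∈ C, x - x₀ ∈ W)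
    (hx₁ : x₁ - x₀ ∈ M) (hslater : ∀ w ∈ W, ∃ c : ℝ, 0 < c ∧ x₁ + c • w ∈ C) :
    ∃ φ : V →ₗ[ℝ] ℝ, (∀ m ∈ M, φ m = 0) ∧ ∀ x ∈ C, φ (x - x₀) ≤ F x - F x₀ := by
  -- Only directions in `W ⊔ M` matter; working inside this subspace is what lets a relative
  -- interior point serve as Slater point. `K` is the epigraph of `F` translated so that `(x₀, F
  -- x₀)` becomes the origin.
  set E : Submodule ℝ V := W ⊔ M with hE
  let K : Set (E × ℝ) := {p | x₀ + (p.1 : V) ∈ C ∧ F (x₀ + (p.1 : V)) - F x₀ ≤ p.2}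
  have hK : Convex ℝ K := by
    intro p hp q hq a b ha hb hab
    have key : x₀ + ((a • p + b • q).1 : V) = a • (x₀ + (p.1 : V)) + b • (x₀ + (q.1 : V)) := by
      have : x₀ = a • x₀ + b • x₀ := by rw [← add_smul, hab, one_smul]
      nth_rewrite 1 [this]
      simp only [Prod.fst_add, Prod.smul_fst, Submodule.coe_add, Submodule.coe_smul, smul_add]
      abel
    refine ⟨?_, ?_⟩
    · rw [key]; exact hF.1 hp.1 hq.1 ha hb hab
    · rw [key]
      have h1 := hF.2 hp.1 hq.1 ha hb hab
      simp only [smul_eq_mul] at h1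
      have h2 := mul_le_mul_of_nonneg_left hp.2 ha
      have h3 := mul_le_mul_of_nonneg_left hq.2 hb
      have h4 : F x₀ = a * F x₀ + b * F x₀ := by rw [← add_mul, hab, one_mul]
      simp only [Prod.snd_add, Prod.smul_snd, smul_eq_mul]
      linarith
  have hs' : ∀ p, p ∈ ConvexCone.hull ℝ K ↔ ∃ c : ℝ, 0 < c ∧ c • p ∈ K := by
    intro p
    rw [ConvexCone.mem_hull_of_convex hK]
    constructor
    · rintro ⟨r, hr, h⟩
      exact ⟨r⁻¹, inv_pos.2 hr, (mem_smul_set_iff_inv_smul_mem₀ hr.ne' _ _).1 h⟩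
    · rintro ⟨c, hc, h⟩
      refine ⟨c⁻¹, inv_pos.2 hc, (mem_smul_set_iff_inv_smul_mem₀ (inv_pos.2 hc).ne' _ _).2 ?_⟩
      rwa [inv_inv]
  have h0 : (ConvexCone.hull ℝ K).Pointed := by
    refine (hs' _).2 ⟨1, one_pos, ?_⟩
    simpa [K] using hx₀
  let s : PointedCone ℝ (E × ℝ) := (ConvexCone.hull ℝ K).toPointedCone h0
  have hs : ∀ p, p ∈ s ↔ ∃ c : ℝ, 0 < c ∧ c • p ∈ K := hs'
  -- On `M × ℝ` the functional `(m, t) ↦ t` is nonnegative on the cone over `K` by minimality. Riesz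
  -- extension makes it a functional `g` nonnegative on the whole cone, and `φ` is `-g` on the
  -- horizontal directions.
  let dom : Submodule ℝ (E × ℝ) := (M.comap E.subtype).prod ⊤
  let f : (E × ℝ) →ₗ.[ℝ] ℝ := ⟨dom, (LinearMap.snd ℝ E ℝ).comp dom.subtype⟩
  obtain ⟨g, hgf, hgs⟩ := riesz_extension s f (by
    rintro ⟨p, hp⟩ hps
    obtain ⟨c, hc, hcK⟩ := (hs p).1 hps
    have hpM : (p.1 : V) ∈ M := hp.1
    have h1 := hmin _ hcK.1 (by
      simpa using M.smul_mem c hpM)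
    have h2 : 0 ≤ c * p.2 := by
      have := hcK.2
      simp only [Prod.smul_snd, smul_eq_mul] at this
      linarith
    exact nonneg_of_mul_nonneg_right h2 hc) (by
    rintro ⟨⟨h, hh⟩, t⟩
    obtain ⟨w, hw, l, hl, rfl⟩ := Submodule.mem_sup.1 hh
    obtain ⟨c, hc, hcC⟩ := hslater w hw
    have hk : -l + c⁻¹ • (x₁ - x₀) ∈ M := M.add_mem (M.neg_mem hl) (M.smul_mem _ hx₁)
    -- Chosen so that, after adding `(w + l, t)` and scaling by `c`, the result is the translated
    -- graph point of `F` over `x₁ + c • w`.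
    refine ⟨⟨(⟨-l + c⁻¹ • (x₁ - x₀), Submodule.mem_sup_right hk⟩,
      c⁻¹ * (F (x₁ + c • w) - F x₀) - t), ⟨hk, trivial⟩⟩, (hs _).2 ⟨c, hc, ?_⟩⟩
    have key : x₀ + c • ((-l + c⁻¹ • (x₁ - x₀)) + (w + l)) = x₁ + c • w := by
      rw [show (-l + c⁻¹ • (x₁ - x₀)) + (w + l) = c⁻¹ • (x₁ - x₀) + w by abel, smul_add,
        smul_inv_smul₀ hc.ne']
      abel
    refine ⟨?_, ?_⟩
    · simpa only [Prod.smul_fst, Prod.fst_add, Submodule.coe_smul, Submodule.coe_add, key]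
        using hcC
    · simp only [Prod.smul_fst, Prod.fst_add, Submodule.coe_smul, Submodule.coe_add, key,
        Prod.smul_snd, Prod.snd_add, smul_eq_mul, sub_add_cancel]
      rw [mul_inv_cancel_left₀ hc.ne'])
  have hg : ∀ (h : E) (t : ℝ), (h : V) ∈ M → g (h, t) = t := fun h t hh =>
    hgf ⟨(h, t), ⟨hh, trivial⟩⟩
  obtain ⟨φ, hφ⟩ := LinearMap.exists_extend (-(g.comp (LinearMap.inl ℝ E ℝ)))
  have hφ' : ∀ h : E, φ h = - g (h, 0) := fun h => by
    have := LinearMap.congr_fun hφ h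
    simpa using this
  refine ⟨φ, fun m hm => ?_, fun x hx => ?_⟩
  · have := hφ' ⟨m, Submodule.mem_sup_right hm⟩
    rw [hg _ _ hm] at this
    simpa using this
  · have h1 := hφ' ⟨x - x₀, Submodule.mem_sup_left (hW x hx)⟩
    have h2 : 0 ≤ g (⟨x - x₀, Submodule.mem_sup_left (hW x hx)⟩, F x - F x₀) := by
      refine hgs _ ((hs _).2 ⟨1, one_pos, ?_⟩)
      simpa [K] using hx
    have h3 : g (⟨x - x₀, Submodule.mem_sup_left (hW x hx)⟩, F x - F x₀) =
        g (⟨x - x₀, Submodule.mem_sup_left (hW x hx)⟩, 0) + (F x - F x₀) := by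
      conv_rhs => rw [← hg 0 (F x - F x₀) (by simp)]
      rw [← map_add]
      simp
    simp only at h1
    linarith

/-- With `M = ⊥` every point is trivially a constrained minimiser, so the multiplier at `y` is a
subgradient. -/
theorem ConvexOn.exists_subgradient {g : ℝ → ℝ} (hg : ConvexOn ℝ univ g) (y : ℝ) :
    ∃ m : ℝ, ∀ z, g y + m * (z - y) ≤ g z := by
  obtain ⟨φ, -, hφ⟩ := exists_multiplier_of_isMinOn hg ⊤ ⊥ (x₀ := y) (x₁ := y) (mem_univ y)
    (fun x _ hx => by rw [sub_eq_zero.1 ((Submodule.mem_bot ℝ).1 hx)]) (fun _ _ => trivial)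
    (by simp) (fun w _ => ⟨1, one_pos, mem_univ _⟩)
  refine ⟨φ 1, fun z => ?_⟩
  have h := hφ z (mem_univ z)
  have h2 : φ (z - y) = φ 1 * (z - y) := by
    rw [mul_comm, ← smul_eq_mul, ← map_smul, smul_eq_mul, mul_one]
  linarith

theorem ConvexOn.continuous_real {g : ℝ → ℝ} (hg : ConvexOn ℝ univ g) : Continuous g := by
  have h := hg.continuousOn_interior
  rwa [interior_univ, continuousOn_univ] at h

theorem nonneg_of_forall_nonneg_add_mul {a b : ℝ}
    (h : ∀ t : ℝ, 0 < t → t ≤ 1 → 0 ≤ a + t * b) : 0 ≤ a := by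
  have hc : Tendsto (fun t : ℝ => a + t * b) (𝓝[>] 0) (𝓝 (a + 0 * b)) :=
    (Continuous.tendsto (by fun_prop) 0).mono_left nhdsWithin_le_nhds
  rw [zero_mul, add_zero] at hc
  refine ge_of_tendsto hc ?_
  filter_upwards [Ioc_mem_nhdsGT (zero_lt_one' ℝ)] with t ht using h t ht.1 ht.2

/-- If `f x - ν x` is minimal over a convex set at `a`, then `f' a - ν` is nonnegative in the
feasible directions. -/
theorem Convex.mul_sub_le_deriv_mul_sub {f : ℝ → ℝ} {C : Set ℝ} (hC : Convex ℝ C) {a ν : ℝ}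
    (hf : DifferentiableAt ℝ f a) (ha : a ∈ C) (h : ∀ x ∈ C, ν * (x - a) ≤ f x - f a)
    {x : ℝ} (hx : x ∈ C) : ν * (x - a) ≤ deriv f a * (x - a) := by
  have hd : HasDerivAt (fun t : ℝ => f (a + t * (x - a))) (deriv f a * (x - a)) 0 := by
    have h1 : HasDerivAt (fun t : ℝ => a + t * (x - a)) (x - a) 0 := by
      simpa using ((hasDerivAt_id (0 : ℝ)).mul_const (x - a)).const_add a
    have h2 : HasDerivAt f (deriv f a) (a + 0 * (x - a)) := by simpa using hf.hasDerivAt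
    exact h2.comp 0 h1
  refine ge_of_tendsto hd.tendsto_slope_zero_right ?_
  filter_upwards [Ioc_mem_nhdsGT (zero_lt_one' ℝ)] with t ht
  have hmem : a + t * (x - a) ∈ C := by
    have := hC ha hx (sub_nonneg.2 ht.2) ht.1.le (sub_add_cancel 1 t)
    simp only [smul_eq_mul] at this
    convert this using 1; ring
  have h3 := h _ hmem
  simp only [zero_add, zero_mul, add_zero, smul_eq_mul]
  rw [inv_mul_eq_div, le_div_iff₀ ht.1]
  linarith

/-! ### Differentiable strongly convex functions on the line -/

section StronglyConvex

variable {f : ℝ → ℝ} {β : ℝ}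

/-- Subtracting `β / 2 * x ^ 2` leaves a differentiable convex function, whose subgradient can only
be its derivative. -/
theorem StrongConvexOn.add_deriv_mul_le (hf : StrongConvexOn univ β f) (hd : Differentiable ℝ f)
    (x y : ℝ) : f x + deriv f x * (y - x) + β / 2 * (y - x) ^ 2 ≤ f y := by
  have hk := strongConvexOn_iff_convex.1 hf
  simp only [Real.norm_eq_abs, sq_abs] at hk
  have hkd : HasDerivAt (fun x => f x - β / 2 * x ^ 2) (deriv f x - β * x) x := by
    refine ((hd x).hasDerivAt.sub (((hasDerivAt_id x).pow 2).const_mul (β / 2))).congr_deriv ?_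
    simp; ring
  obtain ⟨m, hm⟩ := hk.exists_subgradient x
  have hm' : m = deriv f x - β * x := by
    have h : IsLocalMin (fun z => (f z - β / 2 * z ^ 2) - m * (z - x)) x :=
      Eventually.of_forall fun z => by have := hm z; simp only [sub_self, mul_zero]; linarith
    have h' := h.hasDerivAt_eq_zero (hkd.sub (((hasDerivAt_id x).sub_const x).const_mul m))
    linarith
  have h := hm y
  rw [hm'] at h
  nlinarith

theorem StrongConvexOn.mul_sq_le_deriv_sub_mul (hf : StrongConvexOn univ β f)
    (hd : Differentiable ℝ f) (x y : ℝ) :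
    β * (y - x) ^ 2 ≤ (deriv f y - deriv f x) * (y - x) := by
  have h1 := hf.add_deriv_mul_le hd x y
  have h2 := hf.add_deriv_mul_le hd y x
  nlinarith

/-- The derivative is monotone, and it is surjective because it grows at least linearly and has the
Darboux property; a monotone surjection of the line is continuous. -/
theorem StrongConvexOn.continuous_deriv (hβ : 0 < β) (hf : StrongConvexOn univ β f)
    (hd : Differentiable ℝ f) : Continuous (deriv f) := by
  have key := hf.mul_sq_le_deriv_sub_mul hd
  have hlip : ∀ x y, x ≤ y → β * (y - x) ≤ deriv f y - deriv f x := by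
    intro x y hxy
    rcases hxy.eq_or_lt with rfl | hlt
    · simp
    · have h := key x y
      have h' : 0 < y - x := sub_pos.2 hlt
      rw [sq, ← mul_assoc] at h
      exact le_of_mul_le_mul_right h h'
  have hmono : Monotone (deriv f) := fun x y hxy => by
    have := hlip x y hxy
    have h2 := mul_nonneg hβ.le (sub_nonneg.2 hxy)
    linarith
  refine hmono.continuous_of_surjective fun c => ?_
  have hord := (ordConnected_univ (α := ℝ)).image_deriv (f := f) fun x _ => hd x
  -- The radius at which strong monotonicity forces `deriv f (-r) ≤ c ≤ deriv f r`.
  set r := |c - deriv f 0| / β with hr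
  have hr0 : 0 ≤ r := by positivity
  have hr1 : β * r = |c - deriv f 0| := by rw [hr]; field_simp
  have h1 := hlip 0 r hr0
  have h2 := hlip (-r) 0 (by linarith)
  have h3 := le_abs_self (c - deriv f 0)
  have h4 := neg_abs_le (c - deriv f 0)
  obtain ⟨x, -, hx⟩ := hord.out (mem_image_of_mem _ (mem_univ (-r))) (mem_image_of_mem _ (mem_univ r))
    (show c ∈ Icc _ _ from ⟨by linarith, by linarith⟩)
  exact ⟨x, hx⟩

end StronglyConvex

/-! ### Proximal operators of a convex function restricted to a closed set -/

section Prox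

variable {f : ℝ → EReal} {g : ℝ → ℝ} {C : Set ℝ}

theorem exists_isMinOn_add_sq (hC : IsClosed C) (hne : C.Nonempty) (hg : ConvexOn ℝ univ g)
    (y : ℝ) : ∃ a ∈ C, ∀ z ∈ C, g a + (a - y) ^ 2 / 2 ≤ g z + (z - y) ^ 2 / 2 := by
  obtain ⟨x₀, hx₀⟩ := hne
  have hgc := hg.continuous_real
  obtain ⟨m, hm⟩ := hg.exists_subgradient y
  have hcont : Continuous fun z => g z + (z - y) ^ 2 / 2 := by fun_prop
  obtain ⟨a, ha, hmin⟩ := hcont.continuousOn.exists_isMinOn' hC hx₀ (by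
    refine Filter.Eventually.filter_mono inf_le_left ?_
    have hT : Tendsto (fun z : ℝ => ‖z - y‖) (cocompact ℝ) atTop :=
      tendsto_norm_cocompact_atTop.comp
        (Homeomorph.subRight y).isClosedEmbedding.tendsto_cocompact
    set A := g x₀ + (x₀ - y) ^ 2 / 2 with hA
    -- Beyond this radius the quadratic beats the affine minorant of `g` and the value at `x₀`; the
    -- summand `1` ensures `|z - y| ≥ 1`.
    filter_upwards [hT.eventually_ge_atTop (2 * |m| + 2 * |A - g y| + 1)] with z hz
    have h1 := hm z
    rw [Real.norm_eq_abs] at hz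
    have h2 : -(|m| * |z - y|) ≤ m * (z - y) := by rw [← abs_mul]; exact neg_abs_le _
    have h3 := le_abs_self (A - g y)
    have h4 : (z - y) ^ 2 = |z - y| ^ 2 := (sq_abs _).symm
    have h5 := abs_nonneg m
    have h6 := abs_nonneg (A - g y)
    rw [h4]
    nlinarith)
  exact ⟨a, ha, fun z hz => hmin hz⟩

theorem prox_isMinOn (hC : IsClosed C) (hne : C.Nonempty) (hg : ConvexOn ℝ univ g)
    (hf : ∀ z ∈ C, f z = g z) (hf' : ∀ z ∉ C, f z = ⊤) (y : ℝ) :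
    prox f y ∈ C ∧ ∀ z ∈ C, g (prox f y) + (prox f y - y) ^ 2 / 2 ≤ g z + (z - y) ^ 2 / 2 := by
  obtain ⟨a, ha, hmin⟩ := exists_isMinOn_add_sq hC hne hg y
  have hspec : IsMinOn (fun z : ℝ => f z + (((z - y) ^ 2 / 2 : ℝ) : EReal)) univ (prox f y) := by
    refine Classical.epsilon_spec (p := fun x : ℝ =>
      IsMinOn (fun z : ℝ => f z + (((z - y) ^ 2 / 2 : ℝ) : EReal)) univ x) ⟨a, fun z _ => ?_⟩
    by_cases hz : z ∈ C
    · simp only [mem_ofPred_eq, hf a ha, hf z hz]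
      exact_mod_cast hmin z hz
    · simp [hf' z hz]
  have hmem : prox f y ∈ C := by
    by_contra hn
    have h := hspec (mem_univ a)
    simp only [mem_ofPred_eq, hf a ha, hf' _ hn, EReal.top_add_coe] at h
    rw [← EReal.coe_add] at h
    exact absurd (top_le_iff.1 h) (EReal.coe_ne_top _)
  refine ⟨hmem, fun z hz => ?_⟩
  have h := hspec (mem_univ z)
  simp only [mem_ofPred_eq, hf z hz, hf _ hmem] at h
  exact_mod_cast h

/-- Compare the minimiser `a` with `a + t (z - a)`, divide by `t` and let `t → 0`. The inequality
says that `y - prox f y` is a subgradient of `g` plus the indicator of `C`. -/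
theorem prox_variational (hC : IsClosed C) (hconv : Convex ℝ C) (hne : C.Nonempty)
    (hg : ConvexOn ℝ univ g) (hf : ∀ z ∈ C, f z = g z) (hf' : ∀ z ∉ C, f z = ⊤) (y : ℝ) :
    prox f y ∈ C ∧ ∀ z ∈ C, g (prox f y) + (y - prox f y) * (z - prox f y) ≤ g z := by
  obtain ⟨ha, hmin⟩ := prox_isMinOn hC hne hg hf hf' y
  refine ⟨ha, fun z hz => ?_⟩
  set a := prox f y
  suffices 0 ≤ g z - g a - (y - a) * (z - a) by linarith
  refine nonneg_of_forall_nonneg_add_mul (b := (z - a) ^ 2 / 2) fun t ht ht1 => ?_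
  have h0 := hconv ha hz (sub_nonneg.2 ht1) ht.le (sub_add_cancel 1 t)
  have h1 := hmin _ h0
  have h2 := hg.2 (mem_univ a) (mem_univ z) (sub_nonneg.2 ht1) ht.le (sub_add_cancel 1 t)
  simp only [smul_eq_mul] at h1 h2
  have h3 : 0 ≤ t * (g z - g a - (y - a) * (z - a) + t * ((z - a) ^ 2 / 2)) := by
    nlinarith
  exact nonneg_of_mul_nonneg_right h3 ht

theorem prox_eq_of_variational (hC : IsClosed C) (hconv : Convex ℝ C)
    (hg : ConvexOn ℝ univ g) (hf : ∀ z ∈ C, f z = g z) (hf' : ∀ z ∉ C, f z = ⊤) {y a : ℝ}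
    (ha : a ∈ C) (h : ∀ z ∈ C, g a + (y - a) * (z - a) ≤ g z) : prox f y = a := by
  obtain ⟨hb, hb'⟩ := prox_variational hC hconv ⟨a, ha⟩ hg hf hf' y
  have h1 := h _ hb
  have h2 := hb' a ha
  nlinarith [sq_nonneg (prox f y - a)]

/-- Adding the variational inequalities at two arguments shows that the proximal map is
nonexpansive. -/
theorem prox_continuous (hC : IsClosed C) (hconv : Convex ℝ C) (hne : C.Nonempty)
    (hg : ConvexOn ℝ univ g) (hf : ∀ z ∈ C, f z = g z) (hf' : ∀ z ∉ C, f z = ⊤) :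
    Continuous (prox f) := by
  refine LipschitzWith.continuous (K := 1) (LipschitzWith.of_dist_le_mul fun y y' => ?_)
  obtain ⟨ha, ha'⟩ := prox_variational hC hconv hne hg hf hf' y
  obtain ⟨hb, hb'⟩ := prox_variational hC hconv hne hg hf hf' y'
  have h1 := ha' _ hb
  have h2 := hb' _ ha
  rw [NNReal.coe_one, one_mul, Real.dist_eq, Real.dist_eq]
  refine sq_le_sq.1 ?_
  nlinarith [sq_nonneg (prox f y - prox f y' - (y - y'))]

end Prox

/-- The line through `x` along `w` stays in the affine span, where `x` is an interior point. -/
theorem exists_pos_add_smul_mem_of_mem_intrinsicInterior {V : Type*} [NormedAddCommGroup V]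
    [NormedSpace ℝ V] {s : Set V} {x : V} (hx : x ∈ intrinsicInterior ℝ s) {w : V}
    (hw : w ∈ vectorSpan ℝ s) : ∃ c : ℝ, 0 < c ∧ x + c • w ∈ s := by
  obtain ⟨y, hy, rfl⟩ := mem_intrinsicInterior.1 hx
  have hmem : ∀ t : ℝ, (y : V) + t • w ∈ affineSpan ℝ s := fun t => by
    rw [add_comm]
    refine AffineSubspace.vadd_mem_of_mem_direction ?_ y.2
    rw [direction_affineSpan]
    exact Submodule.smul_mem _ t hw
  have hc : Continuous fun t : ℝ => (⟨(y : V) + t • w, hmem t⟩ : affineSpan ℝ s) := by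
    fun_prop
  have h0 : (⟨(y : V) + (0 : ℝ) • w, hmem 0⟩ : affineSpan ℝ s) = y := by
    ext; simp
  have hev := hc.continuousAt.eventually_mem (x := 0) (by
    rw [h0]; exact isOpen_interior.mem_nhds hy)
  obtain ⟨c, hc1, hc2⟩ :=
    ((hev.filter_mono (nhdsWithin_le_nhds (s := Ioi 0))).and self_mem_nhdsWithin).exists
  have hc3 := interior_subset hc1
  exact ⟨c, hc2, hc3⟩

theorem EReal.coe_sum_real {ι : Type*} (s : Finset ι) (f : ι → ℝ) :
    ((∑ i ∈ s, f i : ℝ) : EReal) = ∑ i ∈ s, (f i : EReal) :=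
  map_sum (⟨⟨Real.toEReal, EReal.coe_zero⟩, EReal.coe_add⟩ : ℝ →+ EReal) f s

/-! ### Divergence and Laplacian of the network -/

namespace LoadControl

section Network

variable {N : Type*} [DecidableEq N] (S : LoadControl N)

/-- The net flow out of each bus. -/
noncomputable def divergence : (S.lines → ℝ) →ₗ[ℝ] (N → ℝ) where
  toFun φ i := S.outSum φ i - S.inSum φ i
  map_add' φ ψ := by
    ext i
    simp only [outSum, inSum, Pi.add_apply, Finset.sum_add_distrib]
    ring
  map_smul' c φ := by
    ext i
    simp only [outSum, inSum, Pi.smul_apply, smul_eq_mul, ← Finset.mul_sum, RingHom.id_apply]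
    ring

/-- The linear map `lineFlow`. -/
noncomputable def flow : (N → ℝ) →ₗ[ℝ] (S.lines → ℝ) where
  toFun := S.lineFlow
  map_add' x y := by ext e; simp only [lineFlow, Pi.add_apply]; ring
  map_smul' c x := by
    ext e; simp only [lineFlow, Pi.smul_apply, smul_eq_mul, RingHom.id_apply]; ring

/-- The Laplacian weighted by the susceptances. -/
noncomputable def laplacian : (N → ℝ) →ₗ[ℝ] (N → ℝ) := S.divergence ∘ₗ S.flow

theorem divergence_apply (φ : S.lines → ℝ) (i : N) :
    S.divergence φ i = S.outSum φ i - S.inSum φ i := rfl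

theorem laplacian_apply (x : N → ℝ) (i : N) :
    S.laplacian x i = S.outSum (S.lineFlow x) i - S.inSum (S.lineFlow x) i := rfl

theorem u₁_eq (d ω : N → ℝ) (P : S.lines → ℝ) (i : N) :
    S.u₁ d ω P i = S.Pin i - d i - S.D i * ω i - S.divergence P i := by
  rw [u₁, divergence_apply]; ring

theorem u₂_eq (d θ : N → ℝ) (i : N) :
    S.u₂ d θ i = S.Pin i - d i - S.laplacian θ i := by
  rw [u₂, laplacian_apply]; ring

variable [Fintype N]

/-- Summation by parts: each line contributes once at its source and once, negatively, at its end.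
-/
theorem sum_mul_divergence (x : N → ℝ) (φ : S.lines → ℝ) :
    ∑ i, x i * S.divergence φ i = ∑ e : S.lines, φ e * (x e.1.1 - x e.1.2) := by
  simp only [divergence_apply, outSum, inSum, Finset.sum_filter, mul_sub, Finset.sum_sub_distrib,
    Finset.mul_sum]
  congr 1 <;> rw [Finset.sum_comm] <;> refine Finset.sum_congr rfl fun e _ => ?_ <;>
    simp [mul_comm]

theorem sum_mul_laplacian_comm (x y : N → ℝ) :
    ∑ i, x i * S.laplacian y i = ∑ i, y i * S.laplacian x i := by
  have h : ∀ x y : N → ℝ, ∑ i, x i * S.laplacian y i =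
      ∑ e : S.lines, S.B e * (y e.1.1 - y e.1.2) * (x e.1.1 - x e.1.2) :=
    fun x y => S.sum_mul_divergence x (S.lineFlow y)
  rw [h, h]
  exact Finset.sum_congr rfl fun e _ => by ring

end Network

/-! ### Equilibria, KKT conditions and optimality -/

/-- The assumptions on the costs of the loads. -/
structure Regular {N : Type*} (S : LoadControl N) (β : ℝ) : Prop where
  one_lt : 1 < β
  differentiable : ∀ i, Differentiable ℝ (S.f₀ i)
  strongConvex : ∀ i, StrongConvexOn univ β (S.f₀ i)
  convex : ∀ i, ConvexOn ℝ univ (S.f₂ i)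
  cap_nonempty : ∀ i, (S.cap i).Nonempty

variable {N : Type*} {S : LoadControl N} {β κ : ℝ}

theorem prox_f₁_mem (hne : ∀ i, (S.cap i).Nonempty) (i : N) (y : ℝ) :
    prox (S.f₁ i) y ∈ S.cap i :=
  (prox_isMinOn (g := 0) isClosed_Icc (hne i) (convexOn_const 0 convex_univ)
    (fun _ hz => if_pos hz) (fun _ hz => if_neg hz) y).1

namespace Regular

theorem continuous_deriv (h : S.Regular β) (i : N) : Continuous (deriv (S.f₀ i)) :=
  (h.strongConvex i).continuous_deriv (zero_lt_one.trans h.one_lt) (h.differentiable i)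

theorem prox_f₁_mul_nonpos (h : S.Regular β) (i : N) (y : ℝ) {z : ℝ} (hz : z ∈ S.cap i) :
    (y - prox (S.f₁ i) y) * (z - prox (S.f₁ i) y) ≤ 0 := by
  have := (prox_variational (f := S.f₁ i) (g := 0) isClosed_Icc (convex_Icc _ _)
    (h.cap_nonempty i) (convexOn_const 0 convex_univ) (fun _ hz => if_pos hz)
    (fun _ hz => if_neg hz) y).2 z hz
  simpa only [Pi.zero_apply, zero_add] using this

theorem prox_f₁_eq (i : N) {y a : ℝ} (ha : a ∈ S.cap i)
    (hz : ∀ z ∈ S.cap i, (y - a) * (z - a) ≤ 0) : prox (S.f₁ i) y = a :=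
  prox_eq_of_variational (g := 0) isClosed_Icc (convex_Icc _ _)
    (convexOn_const 0 convex_univ) (fun _ hz => if_pos hz) (fun _ hz => if_neg hz) ha
    fun z hz' => by simpa only [Pi.zero_apply, zero_add] using hz z hz'

theorem continuous_prox_f₁ (h : S.Regular β) (i : N) : Continuous (prox (S.f₁ i)) :=
  prox_continuous (g := 0) isClosed_Icc (convex_Icc _ _) (h.cap_nonempty i)
    (convexOn_const 0 convex_univ) (fun _ hz => if_pos hz) (fun _ hz => if_neg hz)

theorem prox_f₂_le (h : S.Regular β) (i : N) (y z : ℝ) :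
    S.f₂ i (prox (S.f₂E i) y) + (y - prox (S.f₂E i) y) * (z - prox (S.f₂E i) y) ≤ S.f₂ i z :=
  (prox_variational isClosed_univ convex_univ univ_nonempty (h.convex i)
    (fun _ _ => rfl) (fun z hz => absurd (mem_univ z) hz) y).2 z (mem_univ z)

theorem prox_f₂_eq (h : S.Regular β) (i : N) {y a : ℝ}
    (hz : ∀ z, S.f₂ i a + (y - a) * (z - a) ≤ S.f₂ i z) : prox (S.f₂E i) y = a :=
  prox_eq_of_variational isClosed_univ convex_univ (h.convex i)
    (fun _ _ => rfl) (fun z hz => absurd (mem_univ z) hz) (mem_univ a) fun z _ => hz z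

theorem continuous_prox_f₂ (h : S.Regular β) (i : N) : Continuous (prox (S.f₂E i)) :=
  prox_continuous isClosed_univ convex_univ univ_nonempty (h.convex i)
    (fun _ _ => rfl) (fun z hz => absurd (mem_univ z) hz)

end Regular

variable [DecidableEq N]

/-- The optimality conditions that characterize the equilibria of the dynamics. -/
structure OptimalityConditions (S : LoadControl N) (κ : ℝ) (s : S.State) : Prop where
  u₁_eq_zero : ∀ i, S.u₁ s.d s.ω s.P i = 0
  u₂_eq_zero : ∀ i, S.u₂ s.d s.θ i = 0
  ω_eq : ∀ e : S.lines, s.ω e.1.1 = s.ω e.1.2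
  laplacian_μ : S.laplacian s.μ = 0
  mem_cap : ∀ i, s.d i ∈ S.cap i
  mul_nonpos : ∀ i, ∀ z ∈ S.cap i,
    (-deriv (S.f₀ i) (s.d i) + κ * s.η i + s.ω i + s.μ i) * (z - s.d i) ≤ 0
  subgradient : ∀ i z, S.f₂ i (s.d i) - κ * s.η i * (z - s.d i) ≤ S.f₂ i z

theorem Regular.isEquilibrium_iff (h : S.Regular β) (s : S.State) :
    S.IsEquilibrium κ s ↔ S.OptimalityConditions κ s := by
  constructor
  · intro hs
    simp only [IsEquilibrium, dppd, State.mk.injEq] at hs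
    obtain ⟨h1, h2, h3, h4, h5, h6⟩ := hs
    have hu₁ : ∀ i, S.u₁ s.d s.ω s.P i = 0 := fun i => by
      have := congrFun h5 i; simp only [Pi.zero_apply] at this; linarith
    have hu₂ : ∀ i, S.u₂ s.d s.θ i = 0 := fun i => by
      have := congrFun h6 i; simp only [Pi.zero_apply] at this; linarith
    simp only [hu₁, hu₂, add_zero] at h2 h3 h4
    have hd : ∀ i, prox (S.f₁ i) (s.d i - deriv (S.f₀ i) (s.d i) + κ * s.η i + s.ω i + s.μ i) =
        s.d i := fun i => sub_eq_zero.1 (congrFun h2 i)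
    have ha : ∀ i, prox (S.f₂E i) (s.d i - κ * s.η i) = s.d i := fun i =>
      sub_eq_zero.1 (congrFun h1 i)
    refine ⟨hu₁, hu₂, fun e => sub_eq_zero.1 (congrFun h4 e), h3, fun i => ?_, fun i z hz => ?_,
      fun i z => ?_⟩
    · rw [← hd i]; exact prox_f₁_mem h.cap_nonempty i _
    · have := h.prox_f₁_mul_nonpos i
        (s.d i - deriv (S.f₀ i) (s.d i) + κ * s.η i + s.ω i + s.μ i) hz
      rw [hd i] at this
      convert this using 2; ring
    · have := h.prox_f₂_le i (s.d i - κ * s.η i) z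
      rw [ha i] at this
      convert this using 1; ring
  · intro hs
    simp only [IsEquilibrium, dppd, State.mk.injEq, hs.u₁_eq_zero, hs.u₂_eq_zero, add_zero,
      zero_div]
    refine ⟨funext fun i => sub_eq_zero.2 ?_, funext fun i => sub_eq_zero.2 ?_, hs.laplacian_μ,
      funext fun e => sub_eq_zero.2 (hs.ω_eq e), rfl, rfl⟩
    · refine h.prox_f₂_eq i fun z => ?_
      convert hs.subgradient i z using 1; ring
    · refine Regular.prox_f₁_eq i (hs.mem_cap i) fun z hz => ?_
      convert hs.mul_nonpos i z hz using 2; ring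

theorem Slater.cap_nonempty (hS : S.Slater) (i : N) : (S.cap i).Nonempty := by
  obtain ⟨d, hd, -⟩ := hS
  exact ⟨d i, intrinsicInterior_subset hd i⟩

variable [Fintype N]

/-- The capacity box is compact, and balance by some `θ` means `Pin - d` lies in the range of the
Laplacian, a closed subspace. No compactness in `θ` is needed. -/
theorem exists_isMinOn_feasible (h : S.Regular β) (hS : S.Slater) :
    ∃ d ∈ S.capSet, ∃ θ, (∀ i, S.u₂ d θ i = 0) ∧ ∀ d' ∈ S.capSet, ∀ θ', (∀ i, S.u₂ d' θ' i = 0) →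
      ∑ i, (S.f₀ i (d i) + S.f₂ i (d i)) ≤ ∑ i, (S.f₀ i (d' i) + S.f₂ i (d' i)) := by
  have hiff : ∀ d : N → ℝ, S.Pin - d ∈ S.laplacian.range ↔ ∃ θ, ∀ i, S.u₂ d θ i = 0 := by
    intro d
    simp only [LinearMap.mem_range, u₂_eq, funext_iff, Pi.sub_apply]
    exact exists_congr fun θ => forall_congr' fun i => by rw [sub_eq_zero, eq_comm]
  have hcap : S.capSet = Icc S.dlo S.dhi := by
    ext d
    simp only [capSet, cap, mem_ofPred_eq, mem_Icc, Pi.le_def, forall_and]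
  have hcomp : IsCompact (S.capSet ∩ {d | S.Pin - d ∈ S.laplacian.range}) := by
    rw [hcap]
    refine isCompact_Icc.inter_right ?_
    exact (Submodule.closed_of_finiteDimensional S.laplacian.range).preimage (by fun_prop)
  obtain ⟨d₀, hd₀, hθ₀⟩ := hS
  have hf₀ : ∀ i, Continuous (S.f₀ i) := fun i => (h.differentiable i).continuous
  have hf₂ : ∀ i, Continuous (S.f₂ i) := fun i => (h.convex i).continuous_real
  have hcont : Continuous fun d : N → ℝ => ∑ i, (S.f₀ i (d i) + S.f₂ i (d i)) := by fun_prop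
  obtain ⟨d, ⟨hd, hd'⟩, hmin⟩ := hcomp.exists_isMinOn
    ⟨d₀, intrinsicInterior_subset hd₀, (hiff d₀).2 hθ₀⟩ hcont.continuousOn
  obtain ⟨θ, hθ⟩ := (hiff d).1 hd'
  exact ⟨d, hd, θ, hθ, fun d' hd' θ' hθ' => hmin ⟨hd', (hiff d').2 ⟨θ', hθ'⟩⟩⟩

/-- A coordinate of a separable inequality. -/
theorem sum_update_sub (g : N → ℝ → ℝ) (d : N → ℝ) (i : N) (z : ℝ) :
    ∑ j, g j (Function.update d i z j) - ∑ j, g j (d j) = g i z - g i (d i) := by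
  rw [← Finset.sum_sub_distrib, Finset.sum_eq_single i]
  · simp
  · intro j _ hj; simp [hj]
  · simp

theorem Regular.exists_isEquilibrium (h : S.Regular β) (hS : S.Slater) (hκ : 0 < κ) :
    ∃ s : S.State, S.IsEquilibrium κ s := by
  obtain ⟨d, hd, θ, hθ, hmin⟩ := exists_isMinOn_feasible h hS
  obtain ⟨d₁, hd₁, θ₁, hθ₁⟩ := hS
  -- The load is duplicated, one copy for `f₀` and the capacity limits, one for `f₂`. The diagonal
  -- constraint then yields separate multipliers `ν₁`, `ν₂`, so no sum rule for subdifferentials is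
  -- needed.
  let F : (N → ℝ) × (N → ℝ) → ℝ := fun x => ∑ i, S.f₀ i (x.1 i) + ∑ i, S.f₂ i (x.2 i)
  have hconv : Convex ℝ S.capSet := by
    intro x hx y hy a b ha hb hab i
    exact convex_Icc _ _ (hx i) (hy i) ha hb hab
  have hF : ConvexOn ℝ (S.capSet ×ˢ univ) F := by
    refine ⟨hconv.prod convex_univ, fun x _ y _ a b ha hb hab => ?_⟩
    simp only [F, smul_eq_mul, mul_add, Finset.mul_sum, ← Finset.sum_add_distrib]
    refine Finset.sum_le_sum fun i _ => ?_
    have h1 := ((h.strongConvex i).convexOn (fun r => by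
      have := h.one_lt
      positivity)).2 (mem_univ (x.1 i)) (mem_univ (y.1 i)) ha hb hab
    have h2 := (h.convex i).2 (mem_univ (x.2 i)) (mem_univ (y.2 i)) ha hb hab
    simp only [smul_eq_mul, Prod.fst_add, Prod.snd_add, Prod.smul_fst, Prod.smul_snd,
      Pi.add_apply, Pi.smul_apply] at h1 h2 ⊢
    linarith
  obtain ⟨φ, hφM, hφ⟩ := exists_multiplier_of_isMinOn hF ((vectorSpan ℝ S.capSet).prod ⊤)
    (LinearMap.range (S.laplacian.prod S.laplacian)) (x₀ := (d, d)) (x₁ := (d₁, d₁))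
    ⟨hd, mem_univ _⟩ (by
      rintro ⟨d', a'⟩ ⟨hd', -⟩ ⟨ψ, hψ⟩
      simp only [LinearMap.prod_apply, Function.prod_apply, Prod.mk_sub_mk, Prod.mk.injEq] at hψ
      have hda : a' = d' := by
        have := hψ.1.symm.trans hψ.2
        simpa using this.symm
      subst hda
      have := hmin a' hd' (θ - ψ) (fun i => by
        have h1 := hθ i
        have h2 := congrFun hψ.1 i
        rw [u₂_eq] at h1 ⊢
        simp only [map_sub, Pi.sub_apply] at h2 ⊢
        linarith)
      simpa only [F, Finset.sum_add_distrib] using this)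
    (fun x hx => ⟨vsub_mem_vectorSpan ℝ hx.1 hd, trivial⟩)
    ⟨θ - θ₁, by
      have : S.laplacian (θ - θ₁) = d₁ - d := by
        ext i
        have h1 := hθ i
        have h2 := hθ₁ i
        rw [u₂_eq] at h1 h2
        simp only [map_sub, Pi.sub_apply]
        linarith
      simp [this]⟩
    (by
      rintro ⟨w, a⟩ ⟨hw, -⟩
      obtain ⟨c, hc, hc'⟩ := exists_pos_add_smul_mem_of_mem_intrinsicInterior hd₁ hw
      exact ⟨c, hc, hc', mem_univ _⟩)
  let ν₁ : N → ℝ := fun i => φ (Pi.single i 1, 0)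
  let ν₂ : N → ℝ := fun i => φ (0, Pi.single i 1)
  have hsum : ∀ x : N → ℝ, φ (x, x) = ∑ i, (ν₁ i + ν₂ i) * x i := by
    intro x
    have h1 : (x, x) = ∑ i, x i • ((Pi.single i 1, Pi.single i 1) : (N → ℝ) × (N → ℝ)) := by
      refine Prod.ext ?_ ?_ <;>
      · simp only [Prod.fst_sum, Prod.snd_sum, Prod.smul_mk]
        exact pi_eq_sum_univ' x
    rw [h1, map_sum]
    refine Finset.sum_congr rfl fun i _ => ?_
    rw [map_smul, smul_eq_mul, mul_comm]
    congr 1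
    rw [← map_add]
    simp
  -- Since `φ` vanishes on the diagonal image of the Laplacian, testing it on the Laplacian of
  -- `S.laplacian (ν₁ + ν₂)` gives, by symmetry, a vanishing sum of squares.
  have hlap : S.laplacian (ν₁ + ν₂) = 0 := by
    have h1 := hφM (S.laplacian.prod S.laplacian (S.laplacian (ν₁ + ν₂))) ⟨_, rfl⟩
    have h2 : φ (S.laplacian.prod S.laplacian (S.laplacian (ν₁ + ν₂))) = _ :=
      hsum (S.laplacian (S.laplacian (ν₁ + ν₂)))
    rw [h2, show (∑ i, (ν₁ i + ν₂ i) * S.laplacian (S.laplacian (ν₁ + ν₂)) i) = _ from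
      S.sum_mul_laplacian_comm (ν₁ + ν₂) _,
      Finset.sum_eq_zero_iff_of_nonneg fun i _ => mul_self_nonneg _] at h1
    ext i
    simpa using h1 i (Finset.mem_univ i)
  have hν₁ : ∀ i, ∀ z ∈ S.cap i, ν₁ i * (z - d i) ≤ S.f₀ i z - S.f₀ i (d i) := by
    intro i z hz
    have hmem : Function.update d i z ∈ S.capSet := fun j => by
      by_cases hj : j = i
      · subst hj; simpa using hz
      · simpa [hj] using hd j
    have h1 := hφ (Function.update d i z, d) ⟨hmem, mem_univ _⟩
    have h2 : ((Function.update d i z, d) - (d, d) : (N → ℝ) × (N → ℝ)) =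
        (z - d i) • (Pi.single i 1, 0) := by
      ext j
      · by_cases hj : j = i
        · subst hj; simp
        · simp [hj]
      · simp
    have h3 := sum_update_sub S.f₀ d i z
    rw [h2, map_smul, smul_eq_mul, mul_comm] at h1
    simp only [F] at h1
    linarith
  have hν₂ : ∀ i z, ν₂ i * (z - d i) ≤ S.f₂ i z - S.f₂ i (d i) := by
    intro i z
    have h1 := hφ (d, Function.update d i z) ⟨hd, mem_univ _⟩
    have h2 : ((d, Function.update d i z) - (d, d) : (N → ℝ) × (N → ℝ)) =
        (z - d i) • (0, Pi.single i 1) := by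
      ext j
      · simp
      · by_cases hj : j = i
        · subst hj; simp
        · simp [hj]
    have h3 := sum_update_sub S.f₂ d i z
    rw [h2, map_smul, smul_eq_mul, mul_comm] at h1
    simp only [F] at h1
    linarith
  -- With this choice `-κ η = ν₂` is the subgradient of `f₂`, and `κ η + μ = ν₁` the one for `f₀`
  -- with the limits. Taking `ω = 0` and `P` the flow of `θ` makes the two balances coincide.
  refine ⟨⟨fun i => -ν₂ i / κ, d, θ, S.lineFlow θ, 0, ν₁ + ν₂⟩, h.isEquilibrium_iff _ |>.2 ?_⟩
  refine ⟨fun i => ?_, hθ, fun e => rfl, hlap, hd, fun i z hz => ?_, fun i z => ?_⟩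
  · have := hθ i
    rw [u₂_eq] at this
    rw [u₁_eq, ← this]
    simp only [Pi.zero_apply, mul_zero, sub_zero]
    rfl
  · have h1 := (convex_Icc _ _).mul_sub_le_deriv_mul_sub (h.differentiable i (d i)) (hd i)
      (hν₁ i) hz
    simp only [Pi.zero_apply, Pi.add_apply, mul_div_cancel₀ _ hκ.ne']
    linarith
  · have := hν₂ i z
    simp only [mul_div_cancel₀ _ hκ.ne']
    linarith

/-- KKT sufficiency. `ω` serves both as frequency and as multiplier, which is consistent because `D
ω` is the derivative of its own cost; the remaining multiplier terms vanish after summation by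
parts. -/
theorem Regular.isOptimal (h : S.Regular β) {s : S.State} (hs : S.IsEquilibrium κ s) :
    S.IsOptimal s.d s.θ s.ω s.P := by
  have hc := h.isEquilibrium_iff s |>.1 hs
  refine ⟨⟨hc.u₁_eq_zero, hc.u₂_eq_zero⟩, fun d' θ' ω' P' hfeas => ?_⟩
  have hin : ∀ i x, x ∈ S.cap i → ∀ w : ℝ, S.cost i x + ((S.D i / 2 * w ^ 2 : ℝ) : EReal) =
      ((S.f₀ i x + S.f₂ i x + S.D i / 2 * w ^ 2 : ℝ) : EReal) := by
    intro i x hx w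
    simp [cost, f₁, f₂E, hx]
  by_cases hd' : d' ∈ S.capSet
  · rw [objective, objective, Finset.sum_congr rfl fun i _ => hin i _ (hc.mem_cap i) _,
      Finset.sum_congr rfl fun i _ => hin i _ (hd' i) _, ← EReal.coe_sum_real,
      ← EReal.coe_sum_real, EReal.coe_le_coe_iff]
    have hμ : ∑ i, s.μ i * (d' i - s.d i) = 0 := by
      have h1 := S.sum_mul_laplacian_comm s.μ (s.θ - θ')
      simp only [hc.laplacian_μ, Pi.zero_apply, mul_zero, Finset.sum_const_zero] at h1
      rw [← h1]
      refine Finset.sum_congr rfl fun i _ => ?_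
      have h2 := hc.u₂_eq_zero i
      have h3 := hfeas.2 i
      rw [u₂_eq] at h2 h3
      simp only [map_sub, Pi.sub_apply]
      congr 1
      linarith
    have hω : ∑ i, s.ω i * (d' i - s.d i) = ∑ i, s.ω i * (S.D i * (s.ω i - ω' i)) := by
      have h1 := S.sum_mul_divergence s.ω (s.P - P')
      simp only [hc.ω_eq, sub_self, mul_zero, Finset.sum_const_zero] at h1
      rw [← sub_eq_zero, ← Finset.sum_sub_distrib, ← h1]
      refine Finset.sum_congr rfl fun i _ => ?_
      have h2 := hc.u₁_eq_zero i
      have h3 := hfeas.1 i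
      rw [u₁_eq] at h2 h3
      simp only [map_sub, Pi.sub_apply]
      rw [← mul_sub]
      congr 1
      linarith
    have key : ∀ i, S.f₀ i (s.d i) + S.f₂ i (s.d i) + S.D i / 2 * s.ω i ^ 2 +
        (s.μ i * (d' i - s.d i) + (s.ω i * (d' i - s.d i) - s.ω i * (S.D i * (s.ω i - ω' i)))) ≤
        S.f₀ i (d' i) + S.f₂ i (d' i) + S.D i / 2 * ω' i ^ 2 := by
      intro i
      have h1 := (h.strongConvex i).add_deriv_mul_le (h.differentiable i) (s.d i) (d' i)
      have h2 := hc.subgradient i (d' i)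
      have h3 := hc.mul_nonpos i _ (hd' i)
      have h4 : 0 ≤ β / 2 * (d' i - s.d i) ^ 2 := by
        have := h.one_lt
        positivity
      have h5 : 0 ≤ S.D i / 2 * (ω' i - s.ω i) ^ 2 := by
        have := S.D_pos i
        positivity
      linarith
    have hsum := Finset.sum_le_sum fun i (_ : i ∈ Finset.univ) => key i
    rw [Finset.sum_add_distrib, Finset.sum_add_distrib (f := fun i => s.μ i * (d' i - s.d i)),
      Finset.sum_sub_distrib, hμ, hω, sub_self, add_zero, add_zero] at hsum
    exact hsum
  · obtain ⟨i, hi⟩ : ∃ i, d' i ∉ S.cap i := by simpa [capSet] using hd'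
    have hout : ∀ j x, x ∉ S.cap j → S.cost j x = ⊤ := by
      intro j x hx
      simp [cost, f₁, f₂E, hx]
    have hbot : ∀ j, S.cost j (d' j) + ((S.D j / 2 * ω' j ^ 2 : ℝ) : EReal) ≠ ⊥ := by
      intro j
      by_cases hj : d' j ∈ S.cap j
      · rw [hin j _ hj]; exact EReal.coe_ne_bot _
      · rw [hout j _ hj, EReal.top_add_coe]; exact top_ne_bot
    -- One infinite term makes the sum infinite only because no other term is `⊥`.
    have htop : S.objective d' ω' = ⊤ := by
      rw [objective, ← Finset.add_sum_erase _ _ (Finset.mem_univ i)]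
      have h1 : S.cost i (d' i) + ((S.D i / 2 * ω' i ^ 2 : ℝ) : EReal) = ⊤ := by
        rw [hout i _ hi, EReal.top_add_coe]
      rw [h1]
      refine EReal.top_add_of_ne_bot ?_
      refine Finset.sum_induction _ (fun x => x ≠ ⊥) (fun a b ha hb => ?_) (by simp)
        fun j _ => hbot j
      simp [EReal.add_eq_bot_iff, ha, hb]
    rw [htop]
    exact le_top

end LoadControl

/-! ### Distance, boundedness and convergence of states -/

namespace LoadControl

variable {N : Type*} {S : LoadControl N} {β κ : ℝ}

section States

variable [Fintype N]

/-- The squared Euclidean distance of two states. -/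
noncomputable def State.distSq (b s : S.State) : ℝ :=
  ∑ i, ((s.η i - b.η i) ^ 2 + (s.d i - b.d i) ^ 2 + (s.θ i - b.θ i) ^ 2 + (s.ω i - b.ω i) ^ 2 +
    (s.μ i - b.μ i) ^ 2) + ∑ e, (s.P e - b.P e) ^ 2

/-- Convergence of states, coordinate by coordinate. -/
def StateTendsto {ι : Type*} (l : Filter ι) (u : ι → S.State) (s : S.State) : Prop :=
  (∀ i, Tendsto (fun t => (u t).η i) l (𝓝 (s.η i))) ∧
  (∀ i, Tendsto (fun t => (u t).d i) l (𝓝 (s.d i))) ∧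
  (∀ i, Tendsto (fun t => (u t).θ i) l (𝓝 (s.θ i))) ∧
  (∀ e, Tendsto (fun t => (u t).P e) l (𝓝 (s.P e))) ∧
  (∀ i, Tendsto (fun t => (u t).ω i) l (𝓝 (s.ω i))) ∧
  ∀ i, Tendsto (fun t => (u t).μ i) l (𝓝 (s.μ i))

namespace State

theorem distSq_nonneg (b s : S.State) : 0 ≤ State.distSq b s :=
  add_nonneg (Finset.sum_nonneg fun i _ => by positivity)
    (Finset.sum_nonneg fun e _ => sq_nonneg _)

theorem sq_node_le_distSq (b s : S.State) (i : N) :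
    (s.η i - b.η i) ^ 2 + (s.d i - b.d i) ^ 2 + (s.θ i - b.θ i) ^ 2 + (s.ω i - b.ω i) ^ 2 +
      (s.μ i - b.μ i) ^ 2 ≤ distSq b s := by
  refine le_add_of_le_of_nonneg ?_ (Finset.sum_nonneg fun e _ => sq_nonneg _)
  exact Finset.single_le_sum (f := fun i => (s.η i - b.η i) ^ 2 + (s.d i - b.d i) ^ 2 +
    (s.θ i - b.θ i) ^ 2 + (s.ω i - b.ω i) ^ 2 + (s.μ i - b.μ i) ^ 2)
    (fun j _ => by positivity) (Finset.mem_univ i)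

theorem sq_line_le_distSq (b s : S.State) (e : S.lines) :
    (s.P e - b.P e) ^ 2 ≤ distSq b s := by
  refine le_add_of_nonneg_of_le (Finset.sum_nonneg fun i _ => by positivity) ?_
  exact Finset.single_le_sum (f := fun e => (s.P e - b.P e) ^ 2)
    (fun j _ => sq_nonneg _) (Finset.mem_univ e)

/-- A quantity bounding all coordinates of the difference bounds them separately. -/
theorem abs_sub_le_sqrt {b s : S.State} {c : ℝ} (h : distSq b s ≤ c) :
    (∀ i, |s.η i - b.η i| ≤ √c) ∧ (∀ i, |s.d i - b.d i| ≤ √c) ∧ (∀ i, |s.θ i - b.θ i| ≤ √c) ∧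
      (∀ e, |s.P e - b.P e| ≤ √c) ∧ (∀ i, |s.ω i - b.ω i| ≤ √c) ∧ ∀ i, |s.μ i - b.μ i| ≤ √c := by
  refine ⟨fun i => ?_, fun i => ?_, fun i => ?_,
    fun e => Real.abs_le_sqrt ((sq_line_le_distSq b s e).trans h), fun i => ?_, fun i => ?_⟩ <;>
  · refine Real.abs_le_sqrt ?_
    have h1 := sq_node_le_distSq b s i
    have h2 := sq_nonneg (s.η i - b.η i)
    have h3 := sq_nonneg (s.d i - b.d i)
    have h4 := sq_nonneg (s.θ i - b.θ i)
    have h5 := sq_nonneg (s.ω i - b.ω i)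
    have h6 := sq_nonneg (s.μ i - b.μ i)
    linarith

theorem abs_le_of_abs_sub_le {ι : Type*} [Fintype ι] {f g : ι → ℝ} {B c : ℝ} (hB : ‖g‖ + c ≤ B)
    (h : ∀ i, |f i - g i| ≤ c) (i : ι) : |f i| ≤ B := by
  have h1 := abs_add_le (g i) (f i - g i)
  have h2 := norm_le_pi_norm g i
  rw [Real.norm_eq_abs] at h2
  rw [add_sub_cancel] at h1
  linarith [h i]

theorem exists_boundedBy (b : S.State) (c : ℝ) :
    ∃ M, ∀ s : S.State, distSq b s ≤ c → s.BoundedBy M := by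
  have n1 := norm_nonneg b.η
  have n2 := norm_nonneg b.d
  have n3 := norm_nonneg b.θ
  have n4 := norm_nonneg b.P
  have n5 := norm_nonneg b.ω
  have n6 := norm_nonneg b.μ
  refine ⟨‖b.η‖ + ‖b.d‖ + ‖b.θ‖ + ‖b.P‖ + ‖b.ω‖ + ‖b.μ‖ + √c, fun s hs => ?_⟩
  obtain ⟨h1, h2, h3, h4, h5, h6⟩ := abs_sub_le_sqrt hs
  exact ⟨abs_le_of_abs_sub_le (by linarith) h1, abs_le_of_abs_sub_le (by linarith) h2, abs_le_of_abs_sub_le (by linarith) h3,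
    abs_le_of_abs_sub_le (by linarith) h4, abs_le_of_abs_sub_le (by linarith) h5, abs_le_of_abs_sub_le (by linarith) h6⟩

theorem exists_tendsto_subseq {u : ℕ → S.State} {M : ℝ} (hu : ∀ n, (u n).BoundedBy M) :
    ∃ (s : S.State) (φ : ℕ → ℕ), StrictMono φ ∧ StateTendsto atTop (fun n => u (φ n)) s := by
  let v : ℕ → (N → ℝ) × (N → ℝ) × (N → ℝ) × (S.lines → ℝ) × (N → ℝ) × (N → ℝ) := fun n =>
    ((u n).η, (u n).d, (u n).θ, (u n).P, (u n).ω, (u n).μ)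
  have hv : ∀ n, v n ∈ Metric.closedBall 0 |M| := by
    intro n
    obtain ⟨h1, h2, h3, h4, h5, h6⟩ := hu n
    rw [mem_closedBall_zero_iff]
    simp only [v, Prod.norm_mk, sup_le_iff]
    refine ⟨?_, ?_, ?_, ?_, ?_, ?_⟩ <;> refine (pi_norm_le_iff_of_nonneg (abs_nonneg M)).2
      fun i => ?_ <;> rw [Real.norm_eq_abs] <;> refine le_trans ?_ (le_abs_self M)
    exacts [h1 i, h2 i, h3 i, h4 i, h5 i, h6 i]
  obtain ⟨a, -, φ, hφ, ha⟩ := tendsto_subseq_of_bounded Metric.isBounded_closedBall hv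
  have h2 := ha.snd_nhds
  have h3 := h2.snd_nhds
  have h4 := h3.snd_nhds
  have h5 := h4.snd_nhds
  exact ⟨⟨a.1, a.2.1, a.2.2.1, a.2.2.2.1, a.2.2.2.2.1, a.2.2.2.2.2⟩, φ, hφ,
    tendsto_pi_nhds.1 ha.fst_nhds, tendsto_pi_nhds.1 h2.fst_nhds, tendsto_pi_nhds.1 h3.fst_nhds,
    tendsto_pi_nhds.1 h4.fst_nhds, tendsto_pi_nhds.1 h5.fst_nhds, tendsto_pi_nhds.1 h5.snd_nhds⟩

end State

section Limits

variable {ι : Type*} {l : Filter ι} {u : ι → S.State} {s : S.State}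

theorem StateTendsto.of_distSq (h : Tendsto (fun t => State.distSq s (u t)) l (𝓝 0)) :
    StateTendsto l u s := by
  have h0 : Tendsto (fun t => √(State.distSq s (u t))) l (𝓝 0) := by
    simpa using h.sqrt
  have key : ∀ {f : ι → ℝ} {a : ℝ}, (∀ t, |f t - a| ≤ √(State.distSq s (u t))) →
      Tendsto f l (𝓝 a) := fun hf =>
    tendsto_iff_dist_tendsto_zero.2 (squeeze_zero (fun _ => dist_nonneg) hf h0)
  have hab := fun t => State.abs_sub_le_sqrt (le_refl (State.distSq s (u t)))
  exact ⟨fun i => key fun t => (hab t).1 i, fun i => key fun t => (hab t).2.1 i,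
    fun i => key fun t => (hab t).2.2.1 i, fun i => key fun t => (hab t).2.2.2.1 i,
    fun i => key fun t => (hab t).2.2.2.2.1 i, fun i => key fun t => (hab t).2.2.2.2.2 i⟩

theorem StateTendsto.distSq (h : StateTendsto l u s) (b : S.State) :
    Tendsto (fun t => State.distSq b (u t)) l (𝓝 (State.distSq b s)) := by
  obtain ⟨h1, h2, h3, h4, h5, h6⟩ := h
  exact (tendsto_finsetSum _ fun i _ => ((((((h1 i).sub_const _).pow 2).add
    (((h2 i).sub_const _).pow 2)).add (((h3 i).sub_const _).pow 2)).add
    (((h5 i).sub_const _).pow 2)).add (((h6 i).sub_const _).pow 2)).add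
    (tendsto_finsetSum _ fun e _ => ((h4 e).sub_const _).pow 2)

end Limits

end States

theorem tendsto_linearMap_apply {ι : Type*} {l : Filter ι} {m n : Type*} [Finite m] (L : (m → ℝ) →ₗ[ℝ] (n → ℝ))
    {x : ι → m → ℝ} {a : m → ℝ} (h : ∀ i, Tendsto (fun t => x t i) l (𝓝 (a i))) (j : n) :
    Tendsto (fun t => L (x t) j) l (𝓝 (L a j)) :=
  tendsto_pi_nhds.1 ((L.continuous_of_finiteDimensional.tendsto a).comp (tendsto_pi_nhds.2 h)) j

variable [DecidableEq N]

/-! ### Invariance of the capacity limits -/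

theorem IsTrajectoryOn.mem_cap {J : Set ℝ} {z : ℝ → S.State} (hz : S.IsTrajectoryOn κ J z)
    (hne : ∀ i, (S.cap i).Nonempty) (h0 : ∀ i, (z 0).d i ∈ S.cap i) {t : ℝ} (ht : t ∈ J) (i : N) :
    (z t).d i ∈ S.cap i := by
  -- A half-line containing the capacity interval is invariant: `exp τ * (σ * (d - c))` has
  -- derivative `exp τ * (σ * (prox - c)) ≥ 0`. Both endpoints, with `σ = 1` and `σ = -1`, give the
  -- interval.
  have key : ∀ c σ : ℝ, (∀ x ∈ S.cap i, 0 ≤ σ * (x - c)) → 0 ≤ σ * ((z t).d i - c) := by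
    intro c σ hc
    have hd : ∀ τ ∈ J, HasDerivWithinAt (fun τ => Real.exp τ * (σ * ((z τ).d i - c)))
        (Real.exp τ * (σ * ((z τ).d i - c)) + Real.exp τ * (σ * (S.dppd κ (z τ)).d i)) J τ :=
      fun τ hτ => (Real.hasDerivAt_exp τ).hasDerivWithinAt.mul
        (((hz.d τ hτ i).sub_const c).const_mul σ)
    have hmono := monotoneOn_of_hasDerivWithinAt_nonneg hz.interval.convex
      (fun τ hτ => (hd τ hτ).continuousWithinAt)
      (fun τ hτ => (hd τ (interior_subset hτ)).mono interior_subset) (fun τ _ => by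
        have h1 := hc _ (prox_f₁_mem hne i ((z τ).d i - deriv (S.f₀ i) ((z τ).d i) +
          κ * (z τ).η i + ((z τ).ω i + S.u₁ (z τ).d (z τ).ω (z τ).P i) +
          ((z τ).μ i + S.u₂ (z τ).d (z τ).θ i)))
        rw [← mul_add, ← mul_add]
        refine mul_nonneg (Real.exp_pos τ).le ?_
        have h2 : (S.dppd κ (z τ)).d i = prox (S.f₁ i) _ - (z τ).d i := rfl
        rw [h2]
        linarith)
    have h1 := hmono hz.zero_mem ht (hz.nonneg t ht)
    simp only [Real.exp_zero, one_mul] at h1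
    exact nonneg_of_mul_nonneg_right ((hc _ (h0 i)).trans h1) (Real.exp_pos t)
  have h1 := key (S.dlo i) 1 fun x hx => by linarith [hx.1]
  have h2 := key (S.dhi i) (-1) fun x hx => by linarith [hx.2]
  exact ⟨by linarith, by linarith⟩

variable [Fintype N]

/-! ### Continuity of the vector field -/

section Limits

variable {ι : Type*} {l : Filter ι} {u : ι → S.State} {s : S.State}

theorem StateTendsto.u₁ (h : StateTendsto l u s) (i : N) :
    Tendsto (fun t => S.u₁ (u t).d (u t).ω (u t).P i) l (𝓝 (S.u₁ s.d s.ω s.P i)) := by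
  simp only [u₁_eq]
  exact ((tendsto_const_nhds.sub (h.2.1 i)).sub ((h.2.2.2.2.1 i).const_mul _)).sub
    (tendsto_linearMap_apply S.divergence h.2.2.2.1 i)

theorem StateTendsto.u₂ (h : StateTendsto l u s) (i : N) :
    Tendsto (fun t => S.u₂ (u t).d (u t).θ i) l (𝓝 (S.u₂ s.d s.θ i)) := by
  simp only [u₂_eq]
  exact (tendsto_const_nhds.sub (h.2.1 i)).sub
    (tendsto_linearMap_apply S.laplacian h.2.2.1 i)

theorem StateTendsto.dppd (hR : S.Regular β) (h : StateTendsto l u s) (κ : ℝ) :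
    StateTendsto l (fun t => S.dppd κ (u t)) (S.dppd κ s) := by
  have hu₁ := h.u₁
  have hu₂ := h.u₂
  obtain ⟨h1, h2, h3, h4, h5, h6⟩ := h
  have hp := fun i => (h5 i).add (hu₁ i)
  have hq := fun i => (h6 i).add (hu₂ i)
  refine ⟨fun i => ?_, fun i => ?_, fun i => ?_, fun e => (hp _).sub (hp _),
    fun i => (hu₁ i).div_const 2, fun i => (hu₂ i).div_const 2⟩
  · exact (((hR.continuous_prox_f₂ i).tendsto _).comp ((h2 i).sub ((h1 i).const_mul κ))).sub (h2 i)
  · exact (((hR.continuous_prox_f₁ i).tendsto _).comp (((((h2 i).sub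
      (((hR.continuous_deriv i).tendsto _).comp (h2 i))).add ((h1 i).const_mul κ)).add
      (hp i)).add (hq i))).sub (h2 i)
  · exact tendsto_linearMap_apply S.laplacian hq i

end Limits

/-- The squared speed of the dynamics. -/
noncomputable def speedSq (S : LoadControl N) (κ : ℝ) (s : S.State) : ℝ :=
  State.distSq ⟨0, 0, 0, 0, 0, 0⟩ (S.dppd κ s)

theorem isEquilibrium_of_speedSq_eq_zero {s : S.State} (h : S.speedSq κ s = 0) :
    S.IsEquilibrium κ s := by
  obtain ⟨h1, h2, h3, h4, h5, h6⟩ := State.abs_sub_le_sqrt (le_of_eq h)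
  simp only [Pi.zero_apply, sub_zero, Real.sqrt_zero, abs_nonpos_iff] at h1 h2 h3 h4 h5 h6
  rw [IsEquilibrium]
  generalize S.dppd κ s = r at *
  cases r
  exact (State.mk.injEq ..).mpr
    ⟨funext h1, funext h2, funext h3, funext h4, funext h5, funext h6⟩

/-! ### The Lyapunov function and its dissipation -/

/-- The Lyapunov function of the dynamics relative to the state `b`. -/
noncomputable def lyapunov (S : LoadControl N) (κ : ℝ) (b s : S.State) : ℝ :=
  ∑ i, ((s.d i - b.d i) ^ 2 / 2 +
      (S.f₀ i (s.d i) - S.f₀ i (b.d i) - deriv (S.f₀ i) (b.d i) * (s.d i - b.d i)) +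
      κ / 2 * (s.η i - b.η i) ^ 2 - κ * ((s.η i - b.η i) * (s.d i - b.d i)) +
      (s.θ i - b.θ i) ^ 2 / 2 + (1 + 3 * S.D i / 2) * (s.ω i - b.ω i) ^ 2 +
      (s.ω i - b.ω i) * S.u₁ s.d s.ω s.P i + S.u₁ s.d s.ω s.P i ^ 2 / 2 +
      (s.μ i - b.μ i) ^ 2 + (s.μ i - b.μ i) * S.u₂ s.d s.θ i + S.u₂ s.d s.θ i ^ 2 / 2) +
    ∑ e, (s.P e - b.P e) ^ 2 / 2

/-- The derivative of the Lyapunov function along the dynamics. -/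
noncomputable def lyapunovDeriv (S : LoadControl N) (κ : ℝ) (b s : S.State) : ℝ :=
  let r := S.dppd κ s
  ∑ i, ((s.d i - b.d i) * r.d i + (deriv (S.f₀ i) (s.d i) - deriv (S.f₀ i) (b.d i)) * r.d i +
      κ * (s.η i - b.η i) * r.η i - κ * (r.η i * (s.d i - b.d i) + (s.η i - b.η i) * r.d i) +
      (s.θ i - b.θ i) * r.θ i + (2 + 3 * S.D i) * (s.ω i - b.ω i) * r.ω i +
      r.ω i * S.u₁ s.d s.ω s.P i +
      (s.ω i - b.ω i + S.u₁ s.d s.ω s.P i) * (-r.d i - S.D i * r.ω i - S.divergence r.P i) +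
      2 * (s.μ i - b.μ i) * r.μ i + r.μ i * S.u₂ s.d s.θ i +
      (s.μ i - b.μ i + S.u₂ s.d s.θ i) * (-r.d i - S.laplacian r.θ i)) +
    ∑ e, (s.P e - b.P e) * r.P e

theorem lyapunov_self {b : S.State} (h₁ : ∀ i, S.u₁ b.d b.ω b.P i = 0)
    (h₂ : ∀ i, S.u₂ b.d b.θ i = 0) : S.lyapunov κ b b = 0 := by
  simp [lyapunov, h₁, h₂]

theorem StateTendsto.lyapunov {ι : Type*} {l : Filter ι} {u : ι → S.State} {s : S.State}
    (hR : S.Regular β) (h : StateTendsto l u s) (κ : ℝ) (b : S.State) :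
    Tendsto (fun t => S.lyapunov κ b (u t)) l (𝓝 (S.lyapunov κ b s)) := by
  have hu₁ := h.u₁
  have hu₂ := h.u₂
  obtain ⟨h1, h2, h3, h4, h5, h6⟩ := h
  refine (tendsto_finsetSum _ fun i _ => ?_).add
    (tendsto_finsetSum _ fun e _ => (((h4 e).sub_const _).pow 2).div_const 2)
  have hx := (h2 i).sub_const (b.d i)
  have he := (h1 i).sub_const (b.η i)
  have hθ := (h3 i).sub_const (b.θ i)
  have hω := (h5 i).sub_const (b.ω i)
  have hμ := (h6 i).sub_const (b.μ i)
  have hf := (((hR.differentiable i).continuous.tendsto _).comp (h2 i)).sub_const (S.f₀ i (b.d i))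
  exact (((((((((((hx.pow 2).div_const 2).add (hf.sub (hx.const_mul _))).add
    ((he.pow 2).const_mul _)).sub ((he.mul hx).const_mul κ)).add ((hθ.pow 2).div_const 2)).add
    ((hω.pow 2).const_mul _)).add (hω.mul (hu₁ i))).add (((hu₁ i).pow 2).div_const 2)).add
    (hμ.pow 2)).add (hμ.mul (hu₂ i))).add (((hu₂ i).pow 2).div_const 2)

theorem hasDerivWithinAt_linearMap_apply {m n : Type*} [Fintype m] [Fintype n]
    (L : (m → ℝ) →ₗ[ℝ] (n → ℝ)) {x : ℝ → m → ℝ} {x' : m → ℝ} {J : Set ℝ} {t : ℝ}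
    (h : ∀ i, HasDerivWithinAt (fun τ => x τ i) (x' i) J t) (j : n) :
    HasDerivWithinAt (fun τ => L (x τ) j) (L x' j) J t :=
  hasDerivWithinAt_pi.1 ((L.toContinuousLinearMap.hasFDerivAt (x := x t)).comp_hasDerivWithinAt t
    (hasDerivWithinAt_pi.2 h)) j

theorem IsTrajectoryOn.hasDerivWithinAt_lyapunov {J : Set ℝ} {z : ℝ → S.State}
    (hR : S.Regular β) (hz : S.IsTrajectoryOn κ J z) (b : S.State) {t : ℝ} (ht : t ∈ J) :
    HasDerivWithinAt (fun τ => S.lyapunov κ b (z τ)) (S.lyapunovDeriv κ b (z t)) J t := by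
  set r := S.dppd κ (z t) with hr
  have hu₁ : ∀ i, HasDerivWithinAt (fun τ => S.u₁ (z τ).d (z τ).ω (z τ).P i)
      (-r.d i - S.D i * r.ω i - S.divergence r.P i) J t := fun i => by
    simp only [u₁_eq]
    exact (((hz.d t ht i).const_sub _).sub ((hz.ω t ht i).const_mul _)).sub
      (hasDerivWithinAt_linearMap_apply S.divergence (hz.P t ht) i)
  have hu₂ : ∀ i, HasDerivWithinAt (fun τ => S.u₂ (z τ).d (z τ).θ i)
      (-r.d i - S.laplacian r.θ i) J t := fun i => by
    simp only [u₂_eq]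
    exact ((hz.d t ht i).const_sub _).sub
      (hasDerivWithinAt_linearMap_apply S.laplacian (hz.θ t ht) i)
  refine (HasDerivWithinAt.fun_sum fun i _ => ?_).add (HasDerivWithinAt.fun_sum fun e _ => ?_)
  · have hx := (hz.d t ht i).sub_const (b.d i)
    have he := (hz.η t ht i).sub_const (b.η i)
    have hθ := (hz.θ t ht i).sub_const (b.θ i)
    have hω := (hz.ω t ht i).sub_const (b.ω i)
    have hμ := (hz.μ t ht i).sub_const (b.μ i)
    have hf := ((hR.differentiable i ((z t).d i)).hasDerivAt.comp_hasDerivWithinAt t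
      (hz.d t ht i)).sub_const (S.f₀ i (b.d i))
    refine (((((((((((hx.fun_pow 2).div_const 2).add (hf.sub (hx.const_mul _))).add
      ((he.fun_pow 2).const_mul _)).sub ((he.mul hx).const_mul κ)).add
      ((hθ.fun_pow 2).div_const 2)).add ((hω.fun_pow 2).const_mul _)).add (hω.mul (hu₁ i))).add
      (((hu₁ i).fun_pow 2).div_const 2)).add (hμ.fun_pow 2)).add (hμ.mul (hu₂ i))).add
      (((hu₂ i).fun_pow 2).div_const 2) |>.congr_deriv ?_
    simp only [← hr]
    push_cast
    ring
  · refine (((hz.P t ht e).sub_const (b.P e)).fun_pow 2).div_const 2 |>.congr_deriv ?_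
    simp only [← hr]
    push_cast
    ring

/-- The Lyapunov function dominates the distance. -/
theorem Regular.distSq_le_lyapunov (hR : S.Regular β) (hκ : κ ∈ Ioo (0 : ℝ) 1) (b s : S.State) :
    κ * (1 - κ) / 4 * State.distSq b s ≤ S.lyapunov κ b s := by
  obtain ⟨hκ0, hκ1⟩ := hκ
  have hm : κ * (1 - κ) / 4 ≤ 1 / 4 := by nlinarith
  have hm0 : 0 < κ * (1 - κ) / 4 := by
    have := sub_pos.2 hκ1
    positivity
  have hmκ : κ * (1 - κ) / 4 ≤ κ / 4 := by nlinarith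
  have hmκ' : κ * (1 - κ) / 4 ≤ 1 - κ := by nlinarith
  rw [State.distSq, mul_add, Finset.mul_sum, Finset.mul_sum, lyapunov]
  refine add_le_add (Finset.sum_le_sum fun i _ => ?_) (Finset.sum_le_sum fun e _ => ?_)
  · have hf := (hR.strongConvex i).add_deriv_mul_le (hR.differentiable i) (b.d i) (s.d i)
    have hβ := hR.one_lt
    have hD := S.D_pos i
    generalize s.d i - b.d i = x at *
    generalize s.η i - b.η i = e at *
    generalize s.θ i - b.θ i = θ at *
    generalize s.ω i - b.ω i = ω at *
    generalize s.μ i - b.μ i = μ at *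
    generalize S.u₁ s.d s.ω s.P i = a at *
    generalize S.u₂ s.d s.θ i = c at *
    -- As `β > 1`, the Bregman term and `x ^ 2 / 2` together give a full `x ^ 2`, which absorbs the
    -- cross term and leaves `(1 - κ) * x ^ 2`.
    have h1 : x ^ 2 / 2 ≤ β / 2 * x ^ 2 := by nlinarith [sq_nonneg x]
    have h2 : κ * (e * x) ≤ κ / 4 * e ^ 2 + κ * x ^ 2 := by
      nlinarith [mul_nonneg hκ0.le (sq_nonneg (e / 2 - x))]
    have h3 : 0 ≤ 3 * S.D i / 2 * ω ^ 2 := by positivity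
    have h4 : 0 ≤ 3 / 4 * ω ^ 2 + ω * a + a ^ 2 / 2 := by
      nlinarith [sq_nonneg (ω + 2 / 3 * a), sq_nonneg a]
    have h5 : 0 ≤ 3 / 4 * μ ^ 2 + μ * c + c ^ 2 / 2 := by
      nlinarith [sq_nonneg (μ + 2 / 3 * c), sq_nonneg c]
    have k1 := mul_le_mul_of_nonneg_right hmκ (sq_nonneg e)
    have k2 := mul_le_mul_of_nonneg_right hmκ' (sq_nonneg x)
    have k3 := mul_le_mul_of_nonneg_right hm (sq_nonneg θ)
    have k4 := mul_le_mul_of_nonneg_right hm (sq_nonneg ω)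
    have k5 := mul_le_mul_of_nonneg_right hm (sq_nonneg μ)
    linarith [sq_nonneg θ]
  · have := mul_le_mul_of_nonneg_right hm (sq_nonneg (s.P e - b.P e))
    linarith [sq_nonneg (s.P e - b.P e)]

/-- Here `v`, `w` are the velocities of `η`, `d`. The coefficient `2 + 3 * D` makes the products `ω
* a` cancel. After inserting `h₁`, `h₂`, the terms in `v` and `x` are `-v ^ 2 - (1 + κ) * v * x - g
* x`; completing the square costs `(1 + κ) / 2 * x ^ 2`, which `hg` pays for since `β > 1 > (1 + κ)
/ 2`. -/
theorem lyapunov_node_dissipation {κ β D x e v w g ω a μ c : ℝ} (hκ : κ ∈ Ioo (0 : ℝ) 1)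
    (hβ : 1 < β) (hD : 0 < D) (h₂ : 0 ≤ (-v - κ * e) * (v + x))
    (h₁ : 0 ≤ (-w - g + κ * e + (ω + a) + (μ + c)) * (w + x)) (hg : β * x ^ 2 ≤ g * x) :
    x * w + g * w + κ * e * v - κ * (v * x + e * w) + (2 + 3 * D) * ω * (a / 2) + a / 2 * a +
      (ω + a) * (-w - D * (a / 2)) + 2 * μ * (c / 2) + c / 2 * c + (μ + c) * (-w) +
      (ω + a) * (-a - x - D * ω) + (μ + c) * (-c - x) ≤
    -((1 - κ) / 2 * (v ^ 2 + w ^ 2 + (a / 2) ^ 2 + (c / 2) ^ 2)) := by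
  obtain ⟨hκ0, hκ1⟩ := hκ
  have k1 : 0 ≤ (1 + κ) / 2 * (v + x) ^ 2 := by positivity
  have k2 : 0 ≤ D * ω ^ 2 := by positivity
  have k3 : 0 ≤ D * a ^ 2 := by positivity
  have k4 : 0 ≤ (β - (1 + κ) / 2) * x ^ 2 := mul_nonneg (by linarith) (sq_nonneg x)
  have k5 : 0 ≤ (1 + κ) / 2 * w ^ 2 := by positivity
  have k6 : 0 ≤ (1 / 2 - (1 - κ) / 8) * a ^ 2 := mul_nonneg (by linarith) (sq_nonneg a)
  have k7 : 0 ≤ (1 / 2 - (1 - κ) / 8) * c ^ 2 := mul_nonneg (by linarith) (sq_nonneg c)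
  linarith

theorem Regular.lyapunovDeriv_le (hR : S.Regular β) (hκ : κ ∈ Ioo (0 : ℝ) 1) {b : S.State}
    (hb : S.IsEquilibrium κ b) (s : S.State) :
    S.lyapunovDeriv κ b s ≤ -((1 - κ) / 2 * S.speedSq κ s) := by
  have hc := hR.isEquilibrium_iff b |>.1 hb
  set r := S.dppd κ s with hr
  let p : N → ℝ := fun i => s.ω i - b.ω i + S.u₁ s.d s.ω s.P i
  let q : N → ℝ := fun i => s.μ i - b.μ i + S.u₂ s.d s.θ i
  have hrP : ∀ e, r.P e = p e.1.1 - p e.1.2 := fun e => by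
    have := hc.ω_eq e
    simp only [hr, dppd, p]
    linarith
  have hrθ : r.θ = S.laplacian q := by
    have h1 : r.θ = S.laplacian (q + b.μ) := by
      have : (fun i => s.μ i + S.u₂ s.d s.θ i) = q + b.μ := by
        ext i; simp only [q, Pi.add_apply]; ring
      rw [← this]
      rfl
    rw [h1, map_add, hc.laplacian_μ, add_zero]
  have hA : ∑ e, (s.P e - b.P e) * r.P e = ∑ i, p i * S.divergence (s.P - b.P) i := by
    rw [sum_mul_divergence]
    exact Finset.sum_congr rfl fun e _ => by rw [hrP e]; rfl
  have hB : ∑ i, (s.θ i - b.θ i) * r.θ i = ∑ i, q i * S.laplacian (s.θ - b.θ) i := by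
    rw [hrθ, ← sum_mul_laplacian_comm]; rfl
  have hC : ∑ i, p i * S.divergence r.P i = ∑ e, r.P e ^ 2 := by
    rw [sum_mul_divergence]
    exact Finset.sum_congr rfl fun e _ => by rw [hrP e]; ring
  have hE : ∑ i, q i * S.laplacian r.θ i = ∑ i, r.θ i ^ 2 := by
    rw [sum_mul_laplacian_comm, ← hrθ]
    exact Finset.sum_congr rfl fun i _ => (sq _).symm
  -- The bracket on the right collects the network terms, which have no sign at a single bus and are
  -- resolved only after summing over all buses.
  have hnode : ∀ i, (s.d i - b.d i) * r.d i +
      (deriv (S.f₀ i) (s.d i) - deriv (S.f₀ i) (b.d i)) * r.d i +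
      κ * (s.η i - b.η i) * r.η i - κ * (r.η i * (s.d i - b.d i) + (s.η i - b.η i) * r.d i) +
      (s.θ i - b.θ i) * r.θ i + (2 + 3 * S.D i) * (s.ω i - b.ω i) * r.ω i +
      r.ω i * S.u₁ s.d s.ω s.P i +
      (s.ω i - b.ω i + S.u₁ s.d s.ω s.P i) * (-r.d i - S.D i * r.ω i - S.divergence r.P i) +
      2 * (s.μ i - b.μ i) * r.μ i + r.μ i * S.u₂ s.d s.θ i +
      (s.μ i - b.μ i + S.u₂ s.d s.θ i) * (-r.d i - S.laplacian r.θ i) ≤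
      -((1 - κ) / 2 * (r.η i ^ 2 + r.d i ^ 2 + r.ω i ^ 2 + r.μ i ^ 2)) +
        (((s.θ i - b.θ i) * r.θ i - q i * S.laplacian (s.θ - b.θ) i) -
        p i * S.divergence (s.P - b.P) i - p i * S.divergence r.P i -
        q i * S.laplacian r.θ i) := by
    intro i
    have hrω : r.ω i = S.u₁ s.d s.ω s.P i / 2 := rfl
    have hrμ : r.μ i = S.u₂ s.d s.θ i / 2 := rfl
    have hdP : S.divergence (s.P - b.P) i =
        -S.u₁ s.d s.ω s.P i - (s.d i - b.d i) - S.D i * (s.ω i - b.ω i) := by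
      have h := hc.u₁_eq_zero i
      rw [u₁_eq] at h ⊢
      simp only [map_sub, Pi.sub_apply]
      linarith
    have hdθ : S.laplacian (s.θ - b.θ) i = -S.u₂ s.d s.θ i - (s.d i - b.d i) := by
      have h := hc.u₂_eq_zero i
      rw [u₂_eq] at h ⊢
      simp only [map_sub, Pi.sub_apply]
      linarith
    -- Monotonicity of the subdifferential of `f₂`, between the proximal point and `b.d i`; `h₁` is
    -- the analogue for the capacity interval.
    have h₂ : 0 ≤ (-r.η i - κ * (s.η i - b.η i)) * (r.η i + (s.d i - b.d i)) := by
      have h1 := hR.prox_f₂_le i (s.d i - κ * s.η i) (b.d i)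
      have h2 := hc.subgradient i (prox (S.f₂E i) (s.d i - κ * s.η i))
      have h3 : r.η i = prox (S.f₂E i) (s.d i - κ * s.η i) - s.d i := rfl
      rw [h3]
      nlinarith
    have h₁ : 0 ≤ (-r.d i - (deriv (S.f₀ i) (s.d i) - deriv (S.f₀ i) (b.d i)) +
        κ * (s.η i - b.η i) + (s.ω i - b.ω i + S.u₁ s.d s.ω s.P i) +
        (s.μ i - b.μ i + S.u₂ s.d s.θ i)) * (r.d i + (s.d i - b.d i)) := by
      set y := s.d i - deriv (S.f₀ i) (s.d i) + κ * s.η i + (s.ω i + S.u₁ s.d s.ω s.P i) +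
        (s.μ i + S.u₂ s.d s.θ i) with hy
      have h1 := hR.prox_f₁_mul_nonpos i y (hc.mem_cap i)
      have h2 := hc.mul_nonpos i _ (prox_f₁_mem hR.cap_nonempty i y)
      have h3 : r.d i = prox (S.f₁ i) y - s.d i := rfl
      rw [h3]
      nlinarith
    have hg := (hR.strongConvex i).mul_sq_le_deriv_sub_mul (hR.differentiable i) (b.d i) (s.d i)
    have key := lyapunov_node_dissipation hκ hR.one_lt (S.D_pos i) h₂ h₁ hg
    simp only [hdP, hdθ, hrω, hrμ, p, q]
    linarith
  have hsum := Finset.sum_le_sum fun i (_ : i ∈ Finset.univ) => hnode i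
  -- By adjointness the `θ` terms cancel, the term in `s.P - b.P` becomes minus the line part of the
  -- derivative, and the last two become minus the squared speeds of `P` and `θ`.
  conv_rhs at hsum => rw [Finset.sum_add_distrib, Finset.sum_sub_distrib, Finset.sum_sub_distrib,
    Finset.sum_sub_distrib, Finset.sum_sub_distrib, hB, sub_self, hC, hE, ← hA]
  have hspeed : S.speedSq κ s = ∑ i, (r.η i ^ 2 + r.d i ^ 2 + r.ω i ^ 2 + r.μ i ^ 2) +
      ∑ i, r.θ i ^ 2 + ∑ e, r.P e ^ 2 := by
    simp only [speedSq, State.distSq, ← hr, Pi.zero_apply, sub_zero, ← Finset.sum_add_distrib]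
    congr 1
    exact Finset.sum_congr rfl fun i _ => by ring
  have hk : (1 - κ) / 2 ≤ 1 := by linarith [hκ.1]
  have e1 := mul_le_mul_of_nonneg_right hk
    (Finset.sum_nonneg fun i (_ : i ∈ Finset.univ) => sq_nonneg (r.θ i))
  have e2 := mul_le_mul_of_nonneg_right hk
    (Finset.sum_nonneg fun e (_ : e ∈ Finset.univ) => sq_nonneg (r.P e))
  rw [Finset.sum_neg_distrib, ← Finset.mul_sum] at hsum
  rw [hspeed]
  simp only [lyapunovDeriv, ← hr]
  linarith

/-! ### Boundedness and convergence of trajectories -/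

theorem Regular.lyapunov_nonneg (hR : S.Regular β) (hκ : κ ∈ Ioo (0 : ℝ) 1) (b s : S.State) :
    0 ≤ S.lyapunov κ b s := by
  refine le_trans (mul_nonneg ?_ (State.distSq_nonneg b s)) (hR.distSq_le_lyapunov hκ b s)
  have h1 := hκ.1
  have h2 := sub_pos.2 hκ.2
  positivity

theorem IsTrajectoryOn.antitoneOn_lyapunov {J : Set ℝ} {z : ℝ → S.State}
    (hz : S.IsTrajectoryOn κ J z) (hR : S.Regular β) (hκ : κ ∈ Ioo (0 : ℝ) 1) {b : S.State}
    (hb : S.IsEquilibrium κ b) : AntitoneOn (fun t => S.lyapunov κ b (z t)) J :=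
  antitoneOn_of_hasDerivWithinAt_nonpos hz.interval.convex
    (fun _ ht => (hz.hasDerivWithinAt_lyapunov hR b ht).continuousWithinAt)
    (fun _ ht => (hz.hasDerivWithinAt_lyapunov hR b (interior_subset ht)).mono interior_subset)
    fun t _ => (hR.lyapunovDeriv_le hκ hb (z t)).trans (neg_nonpos.2
      (mul_nonneg (by linarith [hκ.2]) (State.distSq_nonneg _ _)))

theorem IsTrajectoryOn.exists_boundedBy {J : Set ℝ} {z : ℝ → S.State}
    (hz : S.IsTrajectoryOn κ J z) (hR : S.Regular β) (hκ : κ ∈ Ioo (0 : ℝ) 1) {b : S.State}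
    (hb : S.IsEquilibrium κ b) : ∃ M : ℝ, ∀ t ∈ J, (z t).BoundedBy M := by
  obtain ⟨M, hM⟩ := State.exists_boundedBy b (S.lyapunov κ b (z 0) / (κ * (1 - κ) / 4))
  refine ⟨M, fun t ht => hM _ ?_⟩
  have h1 := hκ.1
  have h2 := sub_pos.2 hκ.2
  rw [le_div_iff₀' (by positivity)]
  exact (hR.distSq_le_lyapunov hκ b _).trans
    (hz.antitoneOn_lyapunov hR hκ hb hz.zero_mem ht (hz.nonneg t ht))

/-- The mean value theorem on `[n, n + 1]` gives a time whose Lyapunov derivative equals the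
decrement over that interval; decrements of a bounded monotone sequence tend to zero and bound the
squared speed. -/
theorem IsTrajectoryOn.exists_seq_speedSq_tendsto_zero {z : ℝ → S.State}
    (hz : S.IsTrajectoryOn κ (Ici 0) z) (hR : S.Regular β) (hκ : κ ∈ Ioo (0 : ℝ) 1) {b : S.State}
    (hb : S.IsEquilibrium κ b) :
    ∃ t : ℕ → ℝ, (∀ n, 0 ≤ t n) ∧ Tendsto (fun n => S.speedSq κ (z (t n))) atTop (𝓝 0) := by
  set V := fun t => S.lyapunov κ b (z t) with hV
  have hanti := hz.antitoneOn_lyapunov hR hκ hb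
  have hmvt : ∀ n : ℕ, ∃ t ∈ Ioo (n : ℝ) (n + 1),
      S.lyapunovDeriv κ b (z t) = V (n + 1) - V n := by
    intro n
    have hn : (0 : ℝ) ≤ n := n.cast_nonneg
    obtain ⟨t, ht, h⟩ := exists_hasDerivAt_eq_slope V (fun t => S.lyapunovDeriv κ b (z t))
      (lt_add_one (n : ℝ))
      (fun t ht => ((hz.hasDerivWithinAt_lyapunov hR b (hn.trans ht.1)).continuousWithinAt).mono
        fun x hx => hn.trans hx.1)
      (fun t ht => (hz.hasDerivWithinAt_lyapunov hR b (hn.trans ht.1.le)).hasDerivAt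
        (Ici_mem_nhds (hn.trans_lt ht.1)))
    exact ⟨t, ht, by rw [h, add_sub_cancel_left, div_one]⟩
  choose t ht hVt using hmvt
  have ht0 : ∀ n, 0 ≤ t n := fun n => (n.cast_nonneg).trans (ht n).1.le
  have hanti' : Antitone fun n : ℕ => V n := fun m n hmn =>
    hanti (mem_Ici.2 m.cast_nonneg) (mem_Ici.2 n.cast_nonneg) (Nat.cast_le.2 hmn)
  have hlim := tendsto_atTop_ciInf hanti'
    ⟨0, by rintro _ ⟨n, rfl⟩; exact hR.lyapunov_nonneg hκ b _⟩
  have hdiff : Tendsto (fun n : ℕ => (V n - V (n + 1)) / ((1 - κ) / 2)) atTop (𝓝 0) := by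
    have h1 := (tendsto_add_atTop_iff_nat 1).2 hlim
    have h2 := (hlim.sub h1).div_const ((1 - κ) / 2)
    simpa using h2
  refine ⟨t, ht0, squeeze_zero (fun n => State.distSq_nonneg _ _) (fun n => ?_) hdiff⟩
  have h1 := hR.lyapunovDeriv_le hκ hb (z (t n))
  rw [le_div_iff₀' (by linarith [hκ.2])]
  rw [hVt n] at h1
  linarith

theorem IsTrajectoryOn.exists_convergesTo {z : ℝ → S.State}
    (hz : S.IsTrajectoryOn κ (Ici 0) z) (hR : S.Regular β) (hκ : κ ∈ Ioo (0 : ℝ) 1) {b : S.State}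
    (hb : S.IsEquilibrium κ b) : ∃ s, S.IsEquilibrium κ s ∧ ConvergesTo z s := by
  obtain ⟨M, hM⟩ := hz.exists_boundedBy hR hκ hb
  obtain ⟨t, ht0, ht⟩ := hz.exists_seq_speedSq_tendsto_zero hR hκ hb
  obtain ⟨s, φ, hφ, hs⟩ := State.exists_tendsto_subseq fun n => hM (t n) (ht0 n)
  have heq : S.IsEquilibrium κ s := isEquilibrium_of_speedSq_eq_zero
    (tendsto_nhds_unique ((hs.dppd hR κ).distSq _) (ht.comp hφ.tendsto_atTop))
  have hc := hR.isEquilibrium_iff s |>.1 heq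
  have hanti := hz.antitoneOn_lyapunov hR hκ heq
  have hseq := hs.lyapunov hR κ s
  rw [lyapunov_self hc.u₁_eq_zero hc.u₂_eq_zero] at hseq
  -- Monotonicity upgrades smallness at one time `t (φ n)` to all later times, so these times need
  -- not be shown to tend to infinity.
  have hV : Tendsto (fun τ => S.lyapunov κ s (z τ)) atTop (𝓝 0) := by
    refine tendsto_order.2 ⟨fun a ha => Eventually.of_forall fun τ =>
      ha.trans_le (hR.lyapunov_nonneg hκ s _), fun a ha => ?_⟩
    obtain ⟨n, hn⟩ := (hseq.eventually_lt_const ha).exists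
    filter_upwards [eventually_ge_atTop (t (φ n))] with τ hτ
    exact (hanti (ht0 _) ((ht0 _).trans hτ) hτ).trans_lt hn
  have hm : 0 < κ * (1 - κ) / 4 := by
    have h1 := hκ.1
    have h2 := sub_pos.2 hκ.2
    positivity
  refine ⟨s, heq, StateTendsto.of_distSq (squeeze_zero (fun _ => State.distSq_nonneg _ _)
    (fun τ => ?_) (by simpa using hV.div_const (κ * (1 - κ) / 4)))⟩
  rw [le_div_iff₀' hm]
  exact hR.distSq_le_lyapunov hκ s _

end LoadControl

/-! ### The main theorem -/

theorem theorem2 {N : Type*} [Fintype N] [DecidableEq N] (S : LoadControl N) (κ β : ℝ)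
    (hκ : κ ∈ Set.Ioo (0 : ℝ) 1) (hβ : 1 < β)
    (hf₀_diff : ∀ i, Differentiable ℝ (S.f₀ i))
    (hf₀ : ∀ i, StrongConvexOn Set.univ β (S.f₀ i))
    (hf₂ : ∀ i, ConvexOn ℝ Set.univ (S.f₂ i))
    (hSlater : S.Slater) :
    (∀ (J : Set ℝ) (z : ℝ → S.State), S.IsTrajectoryOn κ J z →
      (∀ i, (z 0).d i ∈ S.cap i) → ∀ t ∈ J, ∀ i, (z t).d i ∈ S.cap i) ∧
    (∀ (J : Set ℝ) (z : ℝ → S.State), S.IsTrajectoryOn κ J z →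
      ∃ M : ℝ, ∀ t ∈ J, (z t).BoundedBy M) ∧
    (∀ z : ℝ → S.State, S.IsTrajectoryOn κ (Set.Ici 0) z →
      ∃ s : S.State, S.IsEquilibrium κ s ∧ LoadControl.ConvergesTo z s ∧
        S.IsOptimal s.d s.θ s.ω s.P) := by
  have hne := LoadControl.Slater.cap_nonempty hSlater
  have hR : S.Regular β := ⟨hβ, hf₀_diff, hf₀, hf₂, hne⟩
  obtain ⟨b, hb⟩ := hR.exists_isEquilibrium hSlater hκ.1
  refine ⟨fun J z hz h0 t ht i => hz.mem_cap hne h0 ht i,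
    fun J z hz => hz.exists_boundedBy hR hκ hb, fun z hz => ?_⟩
  obtain ⟨s, hs, hzs⟩ := hz.exists_convergesTo hR hκ hb
  exact ⟨s, hs, hzs, hR.isOptimal hs⟩
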